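/- Let $q$ be a prime power, let $n$ be a prime, and let $n\ge k>r\ge 2$ be integers with $k-r\ge r$. For $\lambda\in\mathbb F_{q^n}$ write $\langle 1,\lambda,\dots,\lambda^{m-1}\rangle_{\mathbb F_q}$ for the $\mathbb F_q$-span of these powers. For an $\mathbb F_q$-subspace $U$ of $\mathbb F_{q^n}^2$ of dimension $k$, let $L_U=\{\langle u\rangle_{\mathbb F_{q^n}}: u\in U\setminus\{0\}\}\subseteq \mathrm{PG}(1,q^n)$ be the associated $\mathbb F_q$-linear set of rank $k$, and let the weight of a point $P=\langle v\rangle_{\mathbb F_{q^n}}$ in $L_U$ be $\dim_{\mathbb F_q}(U\cap\langle v\rangle_{\mathbb F_{q^n}})$. Say that $L_U$ has complementary weights of type $(k-r,r)$ if there are two distinct points of weights $k-r$ and $r$, and that $L_U$ has minimum size if it has at least one point of weight one and exactly $q^{k-1}+1$ points. (A) Let $S,T$ be $\mathbb F_q$-subspaces of $\mathbb F_{q^n}$ of dimensions $k-r$ and $r$, let $T=\langle a_1,\dots,a_r\rangle_{\mathbb F_q}$, and put $j=\dim_{\mathbb F_q}(a_1^{-1}S\cap\dots\cap a_r^{-1}S)$.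 Then $j\le k-2r+1$. If moreover $j=k-2r+1\ge 2$, then $S=g\langle 1,\lambda,\dots,\lambda^{k-r-1}\rangle_{\mathbb F_q}$ and $T=g'\langle 1,\lambda,\dots,\lambda^{r-1}\rangle_{\mathbb F_q}$ for some $g,g',\lambda\in\mathbb F_{q^n}$. (B) Let $L_U$ be an $\mathbb F_q$-linear set of rank $k$ in $\mathrm{PG}(1,q^n)$ with complementary weights of type $(k-r,r)$, and let $P$ be a point of weight $k-r$. Then the number of points of weight $r$ different from $P$ is at most $q^{k-2r+1}$. Suppose moreover that $k>2r$ or $r=2$, and that there are at least $q^{k-2r}+1$ points of weight $r$ different from $P$. Then $L_U$ has minimum size $q^{k-1}+1$, and $U$ is $\mathrm{GL}(2,q^n)$-equivalent to $$\langle 1,\lambda,\dots,\lambda^{r-1}\rangle_{\mathbb F_q}\times\langle 1,\lambda,\dots,\lambda^{k-r-1}\rangle_{\mathbb F_q}$$ for some $\lambda\in\mathbb F_{q^n}\setminus\mathbb F_q$ whose degree $s$ over $\mathbb F_q$ satisfies $k\le s+1$; that is, up to $\mathrm{GL}(2,q^n)$, $L_U$ is a linear set of the Jena–Van de Voorde construction.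 -/

import Mathlib

open scoped Pointwise

namespace LinSet

variable {F E : Type*} [Field F] [Field E] [Algebra F E]

/-- The `F`-linear set `L_U` of `PG(1, E)`: the points spanned by the nonzero vectors of the
`F`-subspace `U` of `E × E`. Its rank is `Module.finrank F U`. -/
def linearSet (U : Submodule F (E × E)) : Set (Projectivization E (E × E)) :=
  {P | ∃ u : E × E, ∃ hu : u ≠ 0, u ∈ U ∧ P = Projectivization.mk E u hu}

/-- The weight of the point `P` in `L_U`: the `F`-dimension of the intersection of `U` with the
one-dimensional `E`-subspace `P`. -/
noncomputable def weight (U : Submodule F (E × E)) (P : Projectivization E (E × E)) : ℕ :=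
  Module.finrank F ↥(U ⊓ P.submodule.restrictScalars F)

/-- `L_U` is a linear set with complementary weights of type `(a, b)`, where `b ≤ a`: it has rank
`a + b` and there are two distinct points of weights `a` and `b`. -/
def HasComplementaryWeights (U : Submodule F (E × E)) (a b : ℕ) : Prop :=
  b ≤ a ∧ Module.finrank F U = a + b ∧
    ∃ P Q : Projectivization E (E × E), P ≠ Q ∧ weight U P = a ∧ weight U Q = b

/-- `L_U` has minimum size: it has at least one point of weight one and exactly `q ^ (k - 1) + 1`
points, where `k` is its rank and `q` is the order of `F`. -/
def IsMinimumSize (U : Submodule F (E × E)) : Prop :=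
  (∃ P : Projectivization E (E × E), weight U P = 1) ∧
    (linearSet U).ncard = Nat.card F ^ (Module.finrank F U - 1) + 1

variable (F) in
/-- The `F`-span of `1, x, …, x ^ (m - 1)`. -/
def powerSpan (x : E) (m : ℕ) : Submodule F E :=
  Submodule.span F (Set.range fun i : Fin m => x ^ (i : ℕ))

/-- `U` is the subspace of the Jena–Van de Voorde construction with parameters `t₁, t₂`: for some
`x ∉ F` of degree `s` over `F` with `1 ≤ t₁, t₂` and `t₁ + t₂ ≤ s + 1`, it consists of the pairs
`(α₀ + α₁ x + ⋯ + α_{t₁-1} x ^ (t₁-1), β₀ + β₁ x + ⋯ + β_{t₂-1} x ^ (t₂-1))`, `αᵢ, βᵢ ∈ F`. -/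
def IsJenaVanDeVoorde (U : Submodule F (E × E)) (t₁ t₂ : ℕ) : Prop :=
  ∃ x : E, x ∉ Set.range (algebraMap F E) ∧ 1 ≤ t₁ ∧ 1 ≤ t₂ ∧
    t₁ + t₂ ≤ Module.finrank F (IntermediateField.adjoin F {x}) + 1 ∧
    U = (powerSpan F x t₁).prod (powerSpan F x t₂)

end LinSet

/-! After a change of coordinates U = T × S with P = ⟨(0,1)⟩, dim T = r and dim S = k - r. The
points of weight r other than P are the ⟨(1,x)⟩ with xT ⊆ S, so there are q^j of them, where j is
the dimension of S / T = {x : xT ⊆ S}, which is also the intersection in (A). Everything thus rests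
on the inclusion (S / T) T ⊆ S.

As n is prime there are no intermediate fields, and the linear Cauchy–Davenport inequality dim AB ≥
dim A + dim B - 1 (for AB ≠ E) bounds j. If the bound is attained and j ≥ 2, then (S / T, T) is an
equality case, and the linear Vosper theorem makes both factors geometric progressions of one ratio.
In (B), a power of q exceeding q^(k-2r) forces the bound to be attained; if k = 2r = 4 then j = 1, S
is a multiple of T, and a plane is always a progression.

Vosper's theorem is proved by counting. Trace duality completes an equality case to a symmetric
triple of subspaces. A smallest non-geometric member T of such triples meets xT in dimension at most
one for x outside F, and this forces T² = uT + vT for all independent u, v in T: T behaves like the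
forms of degree d = dim T - 1 on a projective line. Multiplication modulo u ≠ 0 then generates a
field of degree d, so every u vanishes at d conjugate points over F_{q^d}, whereas a pencil u₀, v₀
sends all these points to P¹(F_{q^d}) with fibres of size at most d. Hence d(1 + q + ⋯ + q^d) ≤
d(q^d + 1), which fails for d ≥ 2.

The minimum size comes from comparing the power-span product with the one whose two lengths are
smaller by one: each point of the larger linear set loses exactly one from its weight, and counting
vectors in both spaces yields the number of points. -/

namespace LinSet

/-! ### Products of subspaces and the linear Cauchy–Davenport inequality. -/

section Products

variable {F E : Type*} [Field F] [Field E] [Algebra F E]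

variable (F E) in
/-- Every element of `E` outside `F` generates `E` over `F`. -/
def NoIntermediate : Prop :=
  ∀ x : E, x ∉ Set.range (algebraMap F E) → Algebra.adjoin F {x} = ⊤

/-- Stability under x is stability under F[x] = E, so W is a nonzero ideal of a field. -/
theorem NoIntermediate.eq_top_of_mul_mem (h : NoIntermediate F E) {x : E}
    (hx : x ∉ Set.range (algebraMap F E)) {W : Submodule F E} (hW : W ≠ ⊥)
    (hs : ∀ w ∈ W, x * w ∈ W) : W = ⊤ := by
  obtain ⟨w₀, hw₀, hne⟩ := (Submodule.ne_bot_iff W).1 hW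
  have key : ∀ c : E, ∀ w ∈ W, c * w ∈ W := by
    intro c
    have hc : c ∈ Algebra.adjoin F {x} := by rw [h x hx]; trivial
    induction hc using Algebra.adjoin_induction with
    | mem y hy => rw [Set.mem_singleton_iff] at hy; subst hy; exact hs
    | algebraMap r => intro w hw; rw [← Algebra.smul_def]; exact W.smul_mem _ hw
    | add a b _ _ ha hb => intro w hw; rw [add_mul]; exact W.add_mem (ha w hw) (hb w hw)
    | mul a b _ _ ha hb => intro w hw; rw [mul_assoc]; exact ha _ (hb _ hw)
  rw [eq_top_iff]
  intro e _
  have := key (e * w₀⁻¹) w₀ hw₀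
  rwa [mul_assoc, inv_mul_cancel₀ hne, mul_one] at this

theorem mem_smul_iff {x : E} (hx : x ≠ 0) {W : Submodule F E} {y : E} :
    y ∈ x • W ↔ x⁻¹ * y ∈ W := by
  rw [Submodule.mem_smul_pointwise_iff_exists]
  constructor
  · rintro ⟨w, hw, rfl⟩
    simpa [smul_eq_mul, inv_mul_cancel_left₀ hx] using hw
  · intro h
    exact ⟨_, h, by simp [smul_eq_mul, mul_inv_cancel_left₀ hx]⟩

theorem mul_mem_smul {x w : E} {W : Submodule F E} (hw : w ∈ W) : x * w ∈ x • W :=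
  Submodule.smul_mem_pointwise_smul w x W hw

theorem smul_le_iff {x : E} {W V : Submodule F E} : x • W ≤ V ↔ ∀ w ∈ W, x * w ∈ V := by
  constructor
  · intro h w hw
    exact h (mul_mem_smul hw)
  · intro h y hy
    obtain ⟨w, hw, rfl⟩ := (Submodule.mem_smul_pointwise_iff_exists _ _ _).1 hy
    exact h w hw

theorem finrank_smul {x : E} (hx : x ≠ 0) (W : Submodule F E) :
    Module.finrank F ↥(x • W) = Module.finrank F W := by
  have : x • W = W.map ((LinearMap.mulLeft F x)) := by
    ext y
    rw [Submodule.mem_smul_pointwise_iff_exists, Submodule.mem_map]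
    rfl
  rw [this]
  exact (Submodule.equivMapOfInjective _ (mul_right_injective₀ hx) W).finrank_eq.symm

theorem smul_mul_submodule (x : E) (S T : Submodule F E) : x • S * T = x • (S * T) := by
  rw [← Submodule.span_singleton_mul, ← Submodule.span_singleton_mul, mul_assoc]

theorem mul_smul_submodule (x : E) (S T : Submodule F E) : S * x • T = x • (S * T) := by
  rw [mul_comm, smul_mul_submodule, mul_comm]

theorem smul_le_mul {x : E} {S T : Submodule F E} (hx : x ∈ S) : x • T ≤ S * T :=
  smul_le_iff.2 fun _ hw => Submodule.mul_mem_mul hx hw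

theorem mul_ne_bot {S T : Submodule F E} (hS : S ≠ ⊥) (hT : T ≠ ⊥) : S * T ≠ ⊥ := by
  obtain ⟨t, ht, hne⟩ := (Submodule.ne_bot_iff T).1 hT
  obtain ⟨s, hs, hse⟩ := (Submodule.ne_bot_iff S).1 hS
  exact (Submodule.ne_bot_iff _).2 ⟨_, Submodule.mul_mem_mul hs ht, mul_ne_zero hse hne⟩

variable [FiniteDimensional F E]

theorem finrank_sup_smul_add_inf {x : E} (hx : x ≠ 0) (S T : Submodule F E) :
    Module.finrank F ↥(S ⊔ x • T) + Module.finrank F ↥(S ⊓ x • T) =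
      Module.finrank F S + Module.finrank F T := by
  rw [Submodule.finrank_sup_add_finrank_inf_eq, finrank_smul hx]

theorem finrank_mul_ge_left (S T : Submodule F E) (hT : T ≠ ⊥) :
    Module.finrank F S ≤ Module.finrank F ↥(S * T) := by
  obtain ⟨t, ht, hne⟩ := (Submodule.ne_bot_iff T).1 hT
  rw [← finrank_smul hne S, mul_comm S T]
  exact Submodule.finrank_mono (smul_le_mul ht)

/-- The linear Cauchy–Davenport inequality. -/
theorem NoIntermediate.finrank_add_le_finrank_mul (h : NoIntermediate F E) :
    ∀ (S T : Submodule F E), S ≠ ⊥ → T ≠ ⊥ → S * T ≠ ⊤ →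
      Module.finrank F S + Module.finrank F T ≤ Module.finrank F ↥(S * T) + 1 := by
  suffices H : ∀ (m : ℕ) (S T : Submodule F E), Module.finrank F T = m → S ≠ ⊥ → T ≠ ⊥ →
      S * T ≠ ⊤ → Module.finrank F S + Module.finrank F T ≤ Module.finrank F ↥(S * T) + 1 from
    fun S T => H _ S T rfl
  intro m
  induction m using Nat.strong_induction_on with
  | _ m IH =>
  intro S T hm hS hT hST
  -- Dyson's transform: (S + xT, T ∩ x⁻¹S) has the same dimension sum, its product stays inside ST,
  -- and its second member is smaller.
  by_cases hex : ∃ x : E, x ≠ 0 ∧ T ⊓ x⁻¹ • S ≠ ⊥ ∧ ¬ T ≤ x⁻¹ • S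
  · obtain ⟨x, hx, h1, h2⟩ := hex
    have hlt : T ⊓ x⁻¹ • S < T := lt_of_le_of_ne inf_le_left fun e => h2 (inf_eq_left.1 e)
    have hle : (S ⊔ x • T) * (T ⊓ x⁻¹ • S) ≤ S * T := by
      rw [Submodule.sup_mul, sup_le_iff]
      refine ⟨mul_le_mul' le_rfl inf_le_left, ?_⟩
      rw [Submodule.mul_le]
      rintro a ha b ⟨-, hb⟩
      rw [mem_smul_iff hx] at ha
      rw [SetLike.mem_coe, mem_smul_iff (inv_ne_zero hx), inv_inv] at hb
      have := Submodule.mul_mem_mul hb ha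
      rwa [show x * b * (x⁻¹ * a) = a * b by field_simp] at this
    have := IH _ (hm ▸ Submodule.finrank_lt_finrank_of_lt hlt) (S ⊔ x • T) (T ⊓ x⁻¹ • S) rfl
      (fun e => hS (sup_eq_bot_iff.1 e).1) h1 (fun e => hST (top_le_iff.1 (e ▸ hle)))
    have h3 := Submodule.finrank_mono hle
    have h4 := finrank_sup_smul_add_inf hx S T
    have h5 : Module.finrank F ↥(S ⊓ x • T) = Module.finrank F ↥(T ⊓ x⁻¹ • S) := by
      rw [← finrank_smul hx (T ⊓ x⁻¹ • S)]
      suffices heq : S ⊓ x • T = x • (T ⊓ x⁻¹ • S) by rw [heq]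
      ext y
      rw [mem_smul_iff hx, Submodule.mem_inf, Submodule.mem_inf, mem_smul_iff hx,
        mem_smul_iff (inv_ne_zero hx), inv_inv, mul_inv_cancel_left₀ hx, and_comm]
    omega
  · push Not at hex
    obtain ⟨t, ht, hne⟩ := (Submodule.ne_bot_iff T).1 hT
    have hleft := finrank_mul_ge_left S T hT
    by_cases hspan : T ≤ Submodule.span F {t}
    · have := (Submodule.finrank_mono hspan).trans (finrank_span_le_card ({t} : Set E))
      simp at this
      omega
    · exfalso
      obtain ⟨t', ht', hnot⟩ := Set.not_subset.1 hspan
      have hy : t' / t ∉ Set.range (algebraMap F E) := by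
        rintro ⟨c, hc⟩
        apply hnot
        rw [SetLike.mem_coe, Submodule.mem_span_singleton]
        exact ⟨c, by rw [Algebra.smul_def, hc, div_mul_cancel₀ _ hne]⟩
      -- No transform shrinks T, so x = s / t, for which t lies in T ∩ x⁻¹S, gives T ⊆ x⁻¹S; hence S
      -- is stable under t' / t, an element outside F.
      have htop : S = ⊤ := by
        refine h.eq_top_of_mul_mem hy hS fun s hs => ?_
        by_cases hs0 : s = 0
        · simp [hs0]
        have hx : s / t ≠ 0 := div_ne_zero hs0 hne
        have := hex (s / t) hx ((Submodule.ne_bot_iff _).2 ⟨t, ⟨ht, ?_⟩, hne⟩) ht'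
        · rw [mem_smul_iff (inv_ne_zero hx), inv_inv] at this
          rwa [show t' / t * s = s / t * t' by ring]
        · rw [SetLike.mem_coe, mem_smul_iff (inv_ne_zero hx), inv_inv, div_mul_cancel₀ _ hne]
          exact hs
      have : Module.finrank F E ≤ Module.finrank F ↥(S * T) := by
        rw [← finrank_top F E, ← htop]; exact hleft
      exact hST (Submodule.eq_top_of_finrank_eq (le_antisymm (Submodule.finrank_le _) this))

end Products

/-! ### Subspaces spanned by geometric progressions. -/

section Geometric

variable {F E : Type*} [Field F] [Field E] [Algebra F E]

theorem pow_mem_powerSpan (x : E) {i m : ℕ} (h : i < m) : x ^ i ∈ powerSpan F x m :=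
  Submodule.subset_span ⟨⟨i, h⟩, rfl⟩

theorem powerSpan_le_iff {x : E} {m : ℕ} {W : Submodule F E} :
    powerSpan F x m ≤ W ↔ ∀ i < m, x ^ i ∈ W := by
  rw [powerSpan, Submodule.span_le, Set.range_subset_iff]
  exact ⟨fun h i hi => h ⟨i, hi⟩, fun h i => h i i.2⟩

theorem powerSpan_mono (x : E) {m l : ℕ} (h : m ≤ l) : powerSpan F x m ≤ powerSpan F x l :=
  powerSpan_le_iff.2 fun _ hi => pow_mem_powerSpan x (hi.trans_le h)

theorem powerSpan_zero (x : E) : powerSpan F x 0 = ⊥ :=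
  le_bot_iff.1 (powerSpan_le_iff.2 fun i hi => absurd hi (Nat.not_lt_zero i))

theorem powerSpan_succ (x : E) (m : ℕ) :
    powerSpan F x (m + 1) = powerSpan F x m ⊔ Submodule.span F {x ^ m} := by
  apply le_antisymm
  · refine powerSpan_le_iff.2 fun i hi => ?_
    rcases Nat.lt_succ_iff_lt_or_eq.1 hi with h | rfl
    · exact Submodule.mem_sup_left (pow_mem_powerSpan x h)
    · exact Submodule.mem_sup_right (Submodule.mem_span_singleton_self _)
  · refine sup_le (powerSpan_mono x m.le_succ) ?_
    rw [Submodule.span_singleton_le_iff_mem]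
    exact pow_mem_powerSpan x m.lt_succ_self

theorem smul_powerSpan_le (x : E) (m : ℕ) : x • powerSpan F x m ≤ powerSpan F x (m + 1) := by
  rw [smul_le_iff]
  intro w hw
  induction hw using Submodule.span_induction with
  | mem y hy =>
    obtain ⟨i, rfl⟩ := hy
    have := pow_mem_powerSpan (F := F) x (Nat.succ_lt_succ i.2)
    rwa [Nat.succ_eq_add_one, pow_succ'] at this
  | zero => simp
  | add a b _ _ ha hb => rw [mul_add]; exact add_mem ha hb
  | smul c a _ ha => rw [mul_smul_comm]; exact Submodule.smul_mem _ c ha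

theorem powerSpan_succ_le_sup (x : E) {m : ℕ} (hm : 1 ≤ m) :
    powerSpan F x (m + 1) ≤ powerSpan F x m ⊔ x • powerSpan F x m := by
  rw [powerSpan_succ, sup_le_iff, Submodule.span_singleton_le_iff_mem]
  refine ⟨le_sup_left, Submodule.mem_sup_right ?_⟩
  obtain ⟨l, rfl⟩ : ∃ l, m = l + 1 := ⟨m - 1, by omega⟩
  rw [pow_succ']
  exact mul_mem_smul (pow_mem_powerSpan x l.lt_succ_self)

theorem powerSpan_mul_le (x : E) (a b : ℕ) :
    powerSpan F x a * powerSpan F x b ≤ powerSpan F x (a + b - 1) := by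
  rw [powerSpan, powerSpan, Submodule.span_mul_span, Submodule.span_le]
  rintro _ ⟨_, ⟨i, rfl⟩, _, ⟨j, rfl⟩, rfl⟩
  have := i.2
  have := j.2
  simp only [← pow_add]
  exact pow_mem_powerSpan x (by omega)

theorem finrank_powerSpan_le (x : E) (m : ℕ) : Module.finrank F (powerSpan F x m) ≤ m :=
  (finrank_range_le_card (R := F) fun i : Fin m => x ^ (i : ℕ)).trans (Fintype.card_fin m).le

theorem smul_smul_submodule (x y : E) (W : Submodule F E) : x • y • W = (x * y) • W :=
  smul_smul x y W

theorem smul_comm_submodule (x y : E) (W : Submodule F E) : x • y • W = y • x • W := by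
  rw [smul_smul, smul_smul, mul_comm]

theorem smul_sup_submodule (x : E) (V W : Submodule F E) : x • (V ⊔ W) = x • V ⊔ x • W :=
  Submodule.smul_sup' x V W

theorem ne_zero_of_notMem_range {x : E} (hx : x ∉ Set.range (algebraMap F E)) : x ≠ 0 := by
  rintro rfl
  exact hx ⟨0, map_zero _⟩

theorem mem_powerSpan_iff {x y : E} {m : ℕ} :
    y ∈ powerSpan F x m ↔ ∃ p : Polynomial F, p.degree < m ∧ Polynomial.aeval x p = y := by
  classical
  have : powerSpan F x m = (Polynomial.degreeLT F m).map (Polynomial.aeval x).toLinearMap := by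
    rw [Polynomial.degreeLT_eq_span_X_pow, Submodule.map_span, powerSpan]
    congr 1
    ext z
    simp [Fin.exists_iff]
  rw [this, Submodule.mem_map]
  simp [Polynomial.mem_degreeLT]

variable [FiniteDimensional F E]

theorem NoIntermediate.natDegree_minpoly (h : NoIntermediate F E) {x : E}
    (hx : x ∉ Set.range (algebraMap F E)) : (minpoly F x).natDegree = Module.finrank F E := by
  have hint : IsIntegral F x := IsIntegral.of_finite F x
  rw [← IntermediateField.adjoin.finrank hint]
  have : IntermediateField.adjoin F {x} = ⊤ := by
    rw [eq_top_iff, ← IntermediateField.toSubalgebra_le_toSubalgebra,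
      IntermediateField.adjoin_simple_toSubalgebra_of_isAlgebraic hint.isAlgebraic, h x hx]
    exact le_top
  rw [this, IntermediateField.finrank_top']

theorem NoIntermediate.pow_notMem_powerSpan (h : NoIntermediate F E) {x : E}
    (hx : x ∉ Set.range (algebraMap F E)) {m : ℕ} (hm : m < Module.finrank F E) :
    x ^ m ∉ powerSpan F x m := by
  rw [mem_powerSpan_iff]
  rintro ⟨p, hp, hpx⟩
  have hdeg : (Polynomial.X ^ m - p).degree = (m : WithBot ℕ) := by
    rw [Polynomial.degree_sub_eq_left_of_degree_lt] <;> rw [Polynomial.degree_X_pow]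
    exact hp
  have hne : Polynomial.X ^ m - p ≠ 0 := by
    intro h0
    rw [h0, Polynomial.degree_zero] at hdeg
    exact absurd hdeg (by simp)
  have := Polynomial.natDegree_le_of_dvd (minpoly.dvd F x (p := Polynomial.X ^ m - p)
    (by simp [hpx])) hne
  rw [h.natDegree_minpoly hx, Polynomial.natDegree_eq_of_degree_eq_some hdeg] at this
  omega

theorem NoIntermediate.finrank_powerSpan (h : NoIntermediate F E) {x : E}
    (hx : x ∉ Set.range (algebraMap F E)) {m : ℕ} (hm : m ≤ Module.finrank F E) :
    Module.finrank F (powerSpan F x m) = m := by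
  induction m with
  | zero => rw [powerSpan_zero, finrank_bot]
  | succ m IH =>
    apply le_antisymm (finrank_powerSpan_le x _)
    have hlt : powerSpan F x m < powerSpan F x (m + 1) :=
      lt_of_le_of_ne (powerSpan_mono x m.le_succ) fun e =>
        h.pow_notMem_powerSpan hx hm (e ▸ pow_mem_powerSpan x m.lt_succ_self)
    have := Submodule.finrank_lt_finrank_of_lt hlt
    have := IH (by omega)
    omega

/-- A subspace that grows by at most one dimension when `x` times it is added is spanned by a
geometric progression of ratio `x`. -/
theorem NoIntermediate.eq_smul_powerSpan (h : NoIntermediate F E) {x : E}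
    (hx : x ∉ Set.range (algebraMap F E)) {W : Submodule F E} (hbot : W ≠ ⊥) (htop : W ≠ ⊤)
    (hW : Module.finrank F ↥(W ⊔ x • W) ≤ Module.finrank F W + 1) :
    ∃ g : E, g ≠ 0 ∧ W = g • powerSpan F x (Module.finrank F W) := by
  have hx0 := ne_zero_of_notMem_range hx
  obtain ⟨m, hm⟩ : ∃ m, Module.finrank F W = m + 1 :=
    ⟨_, (Nat.succ_pred_eq_of_pos (Submodule.one_le_finrank_iff.2 hbot)).symm⟩
  have hlt := Submodule.finrank_lt (lt_top_iff_ne_top.2 htop).ne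
  rw [hm] at hW ⊢
  induction m generalizing W with
  | zero =>
    obtain ⟨g, hg, hne⟩ := (Submodule.ne_bot_iff W).1 hbot
    refine ⟨g, hne, (Submodule.eq_of_le_of_finrank_eq ?_ ?_).symm⟩
    · refine smul_le_iff.2 fun w hw => ?_
      rw [zero_add, powerSpan_succ, powerSpan_zero, bot_sup_eq, pow_zero,
        Submodule.mem_span_singleton] at hw
      obtain ⟨c, rfl⟩ := hw
      rw [mul_smul_comm, mul_one]
      exact W.smul_mem c hg
    · rw [finrank_smul hne, h.finrank_powerSpan hx (by omega), hm]
  | succ m IH =>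
    have hsum := finrank_sup_smul_add_inf hx0 W W
    -- V = W ∩ x⁻¹W has codimension one in W, and V + xV ⊆ W, so V satisfies the same growth
    -- condition and its progression extends by one term to W.
    obtain ⟨V, hV⟩ : ∃ V, x • V = W ⊓ x • W := ⟨x⁻¹ • (W ⊓ x • W), smul_inv_smul₀ hx0 _⟩
    have hVrank : Module.finrank F V = Module.finrank F ↥(W ⊓ x • W) := by
      rw [← hV, finrank_smul hx0]
    have hVW : V ≤ W := by
      have : x • V ≤ x • W := hV ▸ inf_le_right
      intro v hv
      have := this (mul_mem_smul hv)
      rwa [mem_smul_iff hx0, inv_mul_cancel_left₀ hx0] at this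
    have hxVW : x • V ≤ W := hV ▸ inf_le_left
    have hne : V ≠ W := by
      rintro rfl
      exact htop (h.eq_top_of_mul_mem hx hbot (smul_le_iff.1 hxVW))
    have hVlt := Submodule.finrank_lt_finrank_of_lt (lt_of_le_of_ne hVW hne)
    have hVbot : V ≠ ⊥ := Submodule.one_le_finrank_iff.1 (by omega)
    have hVm : Module.finrank F V = m + 1 := by omega
    have hsup : Module.finrank F ↥(V ⊔ x • V) ≤ m + 1 + 1 := by
      have := Submodule.finrank_mono (sup_le hVW hxVW)
      omega
    obtain ⟨g, hg, hVg⟩ := IH hVbot (fun e => htop (top_le_iff.1 (e ▸ hVW))) hsup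
      hVm (by omega)
    refine ⟨g, hg, (Submodule.eq_of_le_of_finrank_eq ?_ ?_).symm⟩
    · calc g • powerSpan F x (m + 1 + 1)
          ≤ g • (powerSpan F x (m + 1) ⊔ x • powerSpan F x (m + 1)) :=
            Submodule.map_mono (powerSpan_succ_le_sup x (by omega))
        _ = V ⊔ x • V := by rw [smul_sup_submodule, smul_comm_submodule, ← hVg]
        _ ≤ W := sup_le hVW hxVW
    · rw [finrank_smul hg, h.finrank_powerSpan hx (by omega), hm]

end Geometric

/-! ### Equality in Cauchy–Davenport: critical triples and trace duality. -/

section Critical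

variable {F E : Type*} [Field F] [Field E] [Algebra F E]

/-- A subspace is geometric if it grows by at most one dimension on adding some multiple of it by
an element outside the base field. -/
def IsGeometric (W : Submodule F E) : Prop :=
  ∃ x : E, x ∉ Set.range (algebraMap F E) ∧
    Module.finrank F ↥(W ⊔ x • W) ≤ Module.finrank F W + 1

/-- A critical triple: three subspaces of dimension at least two, whose dimensions add up to
`[E : F] + 1` and whose triple products have trace zero. -/
structure CriticalTriple (S T R : Submodule F E) : Prop where
  two_le_left : 2 ≤ Module.finrank F S
  two_le_mid : 2 ≤ Module.finrank F T
  two_le_right : 2 ≤ Module.finrank F R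
  finrank_add : Module.finrank F S + Module.finrank F T + Module.finrank F R =
    Module.finrank F E + 1
  trace_eq_zero : ∀ s ∈ S, ∀ t ∈ T, ∀ r ∈ R, Algebra.trace F E (s * t * r) = 0

theorem CriticalTriple.swap {S T R : Submodule F E} (C : CriticalTriple S T R) :
    CriticalTriple T S R where
  two_le_left := C.two_le_mid
  two_le_mid := C.two_le_left
  two_le_right := C.two_le_right
  finrank_add := by have := C.finrank_add; omega
  trace_eq_zero t ht s hs r hr := by rw [mul_comm t s]; exact C.trace_eq_zero s hs t ht r hr

theorem CriticalTriple.swap_right {S T R : Submodule F E} (C : CriticalTriple S T R) :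
    CriticalTriple S R T where
  two_le_left := C.two_le_left
  two_le_mid := C.two_le_right
  two_le_right := C.two_le_mid
  finrank_add := by have := C.finrank_add; omega
  trace_eq_zero s hs r hr t ht := by rw [mul_right_comm]; exact C.trace_eq_zero s hs t ht r hr

theorem ne_bot_of_finrank {W : Submodule F E} (h : 2 ≤ Module.finrank F W) : W ≠ ⊥ := by
  rintro rfl
  rw [finrank_bot] at h
  omega

theorem ne_top_of_finrank {W : Submodule F E}
    (h : Module.finrank F W < Module.finrank F E) : W ≠ ⊤ := by
  rintro rfl
  rw [finrank_top] at h
  omega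

theorem div_notMem_range {u v : E} (hu : u ≠ 0) (hv : v ∉ Submodule.span F {u}) :
    v / u ∉ Set.range (algebraMap F E) := by
  rintro ⟨c, hc⟩
  exact hv (Submodule.mem_span_singleton.2 ⟨c, by rw [Algebra.smul_def, hc, div_mul_cancel₀ _ hu]⟩)

theorem ne_zero_of_notMem_span {u v : E} (hv : v ∉ Submodule.span F {u}) : v ≠ 0 := by
  rintro rfl
  exact hv (zero_mem _)

theorem exists_notMem_span {W : Submodule F E} (hW : 2 ≤ Module.finrank F W) (u : E) :
    ∃ v ∈ W, v ∉ Submodule.span F {u} := by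
  by_contra! hcon
  have := (Submodule.finrank_mono (show W ≤ Submodule.span F {u} from hcon)).trans
    (finrank_span_le_card ({u} : Set E))
  simp at this
  omega

theorem finrank_smul_inf_smul {u : E} (hu : u ≠ 0) (v : E) (W : Submodule F E) :
    Module.finrank F ↥(u • W ⊓ v • W) = Module.finrank F ↥(W ⊓ (v / u) • W) := by
  rw [← finrank_smul hu (W ⊓ (v / u) • W)]
  suffices heq : u • W ⊓ v • W = u • (W ⊓ (v / u) • W) by rw [heq]
  ext y
  rw [mem_smul_iff hu, Submodule.mem_inf, Submodule.mem_inf, mem_smul_iff hu]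
  conv_lhs => rw [← mul_div_cancel₀ v hu, ← smul_smul_submodule, mem_smul_iff hu]

theorem CriticalTriple.mul_le_orthogonal {S T R : Submodule F E} (C : CriticalTriple S T R) :
    S * T ≤ (Algebra.traceForm F E).orthogonal R := by
  rw [Submodule.mul_le]
  intro s hs t ht
  rw [LinearMap.BilinForm.mem_orthogonal_iff]
  intro r hr
  rw [Algebra.traceForm_apply, mul_comm]
  exact C.trace_eq_zero s hs t ht r hr

theorem smul_sup_smul_le_mul {u v : E} {T B : Submodule F E} (hu : u ∈ T) (hv : v ∈ T) :
    u • B ⊔ v • B ≤ T * B :=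
  sup_le (smul_le_mul hu) (smul_le_mul hv)

theorem mul_smul_le_inf {u v : E} {T B : Submodule F E} (hu : u ∈ T) (hv : v ∈ T) :
    (u * v) • B ≤ u • (T * B) ⊓ v • (T * B) := by
  refine le_inf ?_ ?_
  · rw [← smul_smul_submodule]
    exact Submodule.map_mono (smul_le_mul hv)
  · rw [mul_comm, ← smul_smul_submodule]
    exact Submodule.map_mono (smul_le_mul hu)

variable [FiniteDimensional F E]

theorem NoIntermediate.finrank_inf_smul_lt (h : NoIntermediate F E) {x : E}
    (hx : x ∉ Set.range (algebraMap F E)) {W : Submodule F E} (hbot : W ≠ ⊥) (htop : W ≠ ⊤) :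
    Module.finrank F ↥(W ⊓ x • W) < Module.finrank F W := by
  refine Submodule.finrank_lt_finrank_of_lt (lt_of_le_of_ne inf_le_left fun e => htop ?_)
  have hx0 := ne_zero_of_notMem_range hx
  have hle : W ≤ x • W := inf_eq_left.1 e
  have heq : W = x • W := Submodule.eq_of_le_of_finrank_eq hle (finrank_smul hx0 W).symm
  exact h.eq_top_of_mul_mem hx hbot (smul_le_iff.1 heq.ge)

/-- For a basis u, v of W and x = v / u, the vector v lies in both W and xW. -/
theorem isGeometric_of_finrank_eq_two {W : Submodule F E} (hW : Module.finrank F W = 2) :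
    IsGeometric W := by
  obtain ⟨u, hu, hne⟩ := (Submodule.ne_bot_iff W).1 (ne_bot_of_finrank hW.ge)
  obtain ⟨v, hv, hvu⟩ := exists_notMem_span hW.ge u
  refine ⟨v / u, div_notMem_range hne hvu, ?_⟩
  have h1 := finrank_sup_smul_add_inf (div_ne_zero (ne_zero_of_notMem_span hvu) hne) W W
  have h2 : 1 ≤ Module.finrank F ↥(W ⊓ (v / u) • W) := by
    rw [Submodule.one_le_finrank_iff, Submodule.ne_bot_iff]
    refine ⟨v, ⟨hv, ?_⟩, ne_zero_of_notMem_span hvu⟩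
    have := mul_mem_smul (x := v / u) hu
    rwa [div_mul_cancel₀ _ hne] at this
  omega

/-- Each further power of x strictly enlarges a proper product, so a total growth of at most b - 1
leaves at most 1 for the first step from S to S + xS. -/
theorem NoIntermediate.finrank_sup_smul_le (h : NoIntermediate F E) {x : E}
    (hx : x ∉ Set.range (algebraMap F E)) {S : Submodule F E} (hS : S ≠ ⊥) {b : ℕ} (hb : 2 ≤ b)
    (htop : S * powerSpan F x b ≠ ⊤)
    (hle : Module.finrank F ↥(S * powerSpan F x b) + 1 ≤ Module.finrank F S + b) :
    Module.finrank F ↥(S ⊔ x • S) ≤ Module.finrank F S + 1 := by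
  induction b, hb using Nat.le_induction with
  | base =>
    have : S ⊔ x • S ≤ S * powerSpan F x 2 := by
      refine sup_le (fun s hs => ?_) (smul_le_iff.2 fun s hs => ?_)
      · simpa using Submodule.mul_mem_mul hs (pow_mem_powerSpan (F := F) x (show 0 < 2 by omega))
      · have := Submodule.mul_mem_mul hs (pow_mem_powerSpan (F := F) x (show 1 < 2 by omega))
        rwa [pow_one, mul_comm s] at this
    have := Submodule.finrank_mono this
    omega
  | succ b hb IH =>
    have hmono : S * powerSpan F x b ≤ S * powerSpan F x (b + 1) :=
      mul_le_mul' le_rfl (powerSpan_mono x b.le_succ)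
    have htop' : S * powerSpan F x b ≠ ⊤ := fun e => htop (top_le_iff.1 (e ▸ hmono))
    have hlt : S * powerSpan F x b < S * powerSpan F x (b + 1) := by
      refine lt_of_le_of_ne hmono fun e => htop' ?_
      refine h.eq_top_of_mul_mem hx (mul_ne_bot hS ?_) (smul_le_iff.1 ?_)
      · exact (Submodule.ne_bot_iff _).2
          ⟨x ^ 0, pow_mem_powerSpan x (by omega), by simp⟩
      · rw [← mul_smul_submodule]
        conv_rhs => rw [e]
        exact mul_le_mul' le_rfl (smul_powerSpan_le x b)
    have := Submodule.finrank_lt_finrank_of_lt hlt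
    exact IH htop' (by omega)

theorem finrank_smul_sup_smul {u v : E} (hu : u ≠ 0) (hv : v ≠ 0) (B : Submodule F E) :
    Module.finrank F ↥(u • B ⊔ v • B) + Module.finrank F ↥(u • B ⊓ v • B) =
      2 * Module.finrank F B := by
  rw [Submodule.finrank_sup_add_finrank_inf_eq, finrank_smul hu, finrank_smul hv, two_mul]

variable [Algebra.IsSeparable F E]

/-- ST lies in the trace-orthogonal of R, whose dimension n - dim R is exactly the Cauchy–Davenport
lower bound for ST. -/
theorem CriticalTriple.finrank_mul {S T R : Submodule F E} (C : CriticalTriple S T R)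
    (h : NoIntermediate F E) :
    S * T ≠ ⊤ ∧ Module.finrank F ↥(S * T) + 1 = Module.finrank F S + Module.finrank F T := by
  have h1 := Submodule.finrank_mono C.mul_le_orthogonal
  rw [LinearMap.BilinForm.finrank_orthogonal (traceForm_nondegenerate F E)] at h1
  have h2 := C.finrank_add
  have h3 := C.two_le_right
  have h4 := C.two_le_left
  have h5 : S * T ≠ ⊤ := ne_top_of_finrank (by omega)
  have h6 := h.finrank_add_le_finrank_mul S T (ne_bot_of_finrank C.two_le_left)
    (ne_bot_of_finrank C.two_le_mid) h5
  exact ⟨h5, by omega⟩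

/-- The third member is the trace-orthogonal of ST; the gap of two below [E : F] gives it dimension
at least two. -/
theorem CriticalTriple.of_finrank_mul (h : NoIntermediate F E) {S T : Submodule F E}
    (hS : 2 ≤ Module.finrank F S) (hT : 2 ≤ Module.finrank F T)
    (hST : Module.finrank F ↥(S * T) + 1 ≤ Module.finrank F S + Module.finrank F T)
    (hn : Module.finrank F ↥(S * T) + 2 ≤ Module.finrank F E) :
    ∃ R, CriticalTriple S T R := by
  have h6 := h.finrank_add_le_finrank_mul S T (ne_bot_of_finrank hS) (ne_bot_of_finrank hT)
    (ne_top_of_finrank (by omega))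
  have h7 := LinearMap.BilinForm.finrank_orthogonal (traceForm_nondegenerate F E) (S * T)
  refine ⟨(Algebra.traceForm F E).orthogonal (S * T), hS, hT, by omega, by omega, ?_⟩
  intro s hs t ht r hr
  exact hr _ (Submodule.mul_mem_mul hs ht)

theorem CriticalTriple.finrank_sup_smul_le {S T R : Submodule F E} (C : CriticalTriple S T R)
    (h : NoIntermediate F E) {x : E} (hx : x ∉ Set.range (algebraMap F E))
    (hT : Module.finrank F ↥(T ⊔ x • T) ≤ Module.finrank F T + 1) :
    Module.finrank F ↥(S ⊔ x • S) ≤ Module.finrank F S + 1 := by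
  have h1 := C.finrank_add
  have h2 := C.two_le_left
  have h3 := C.two_le_right
  obtain ⟨g, hg, hTg⟩ := h.eq_smul_powerSpan hx (ne_bot_of_finrank C.two_le_mid)
    (ne_top_of_finrank (by omega)) hT
  obtain ⟨htop, hrank⟩ := C.finrank_mul h
  have heq : S * T = g • (S * powerSpan F x (Module.finrank F T)) := by
    conv_lhs => rw [hTg, mul_smul_submodule]
  have hfin : Module.finrank F ↥(S * T) =
      Module.finrank F ↥(S * powerSpan F x (Module.finrank F T)) := by
    rw [heq, finrank_smul hg]
  refine h.finrank_sup_smul_le hx (ne_bot_of_finrank C.two_le_left) C.two_le_mid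
    (ne_top_of_finrank ?_) (by omega)
  have := Submodule.finrank_lt htop
  omega

theorem CriticalTriple.isGeometric_left {S T R : Submodule F E} (C : CriticalTriple S T R)
    (h : NoIntermediate F E) (hT : IsGeometric T) : IsGeometric S := by
  obtain ⟨x, hx, hxT⟩ := hT
  exact ⟨x, hx, C.finrank_sup_smul_le h hx hxT⟩

/-- Submodularity: S(T + xT) and S(T ∩ xT) have dimensions summing to at most 2 dim ST. Were the
second pair not critical, dim T ≤ dim R would keep S(T + xT) proper, and Cauchy–Davenport there
would make the sum too large. -/
theorem CriticalTriple.inf_smul {S T R : Submodule F E} (C : CriticalTriple S T R)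
    (h : NoIntermediate F E) (hTR : Module.finrank F T ≤ Module.finrank F R) {x : E} (hx : x ≠ 0)
    (hi : 2 ≤ Module.finrank F ↥(T ⊓ x • T)) : ∃ R', CriticalTriple S (T ⊓ x • T) R' := by
  have h1 := C.finrank_add
  have h2 := C.two_le_left
  obtain ⟨htop, hrank⟩ := C.finrank_mul h
  have hsub := Submodule.finrank_sup_add_finrank_inf_eq (S * T) (S * x • T)
  have hsup : S * (T ⊔ x • T) = S * T ⊔ S * x • T := Submodule.mul_sup _ _ _
  have hinf : S * (T ⊓ x • T) ≤ S * T ⊓ S * x • T :=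
    le_inf (mul_le_mul' le_rfl inf_le_left) (mul_le_mul' le_rfl inf_le_right)
  have hinf' := Submodule.finrank_mono hinf
  have hinfT : Module.finrank F ↥(S * (T ⊓ x • T)) ≤ Module.finrank F ↥(S * T) :=
    Submodule.finrank_mono (hinf.trans inf_le_left)
  have hx2 : Module.finrank F ↥(S * x • T) = Module.finrank F ↥(S * T) := by
    rw [mul_smul_submodule, finrank_smul hx]
  have hdim := finrank_sup_smul_add_inf hx T T
  have hr := C.two_le_right
  by_contra hcon
  have hlt : ¬ Module.finrank F ↥(S * (T ⊓ x • T)) + 1 ≤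
      Module.finrank F S + Module.finrank F ↥(T ⊓ x • T) := fun hle =>
    hcon (CriticalTriple.of_finrank_mul h C.two_le_left hi hle (by omega))
  rw [← hsup] at hsub
  have hT : T ⊔ x • T ≠ ⊥ := fun e => ne_bot_of_finrank C.two_le_mid (sup_eq_bot_iff.1 e).1
  have := h.finrank_add_le_finrank_mul S (T ⊔ x • T) (ne_bot_of_finrank C.two_le_left) hT
    (ne_top_of_finrank (by omega))
  omega

/-- Otherwise T ∩ xT is a smaller partner of S; by minimality it is geometric, and geometricity
passes through S back to T. -/
theorem CriticalTriple.finrank_inf_smul_le_one {S T R : Submodule F E}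
    (C : CriticalTriple S T R) (h : NoIntermediate F E) (hT : ¬ IsGeometric T)
    (hTR : Module.finrank F T ≤ Module.finrank F R)
    (hmin : ∀ T' R', CriticalTriple S T' R' → ¬ IsGeometric T' →
      Module.finrank F T ≤ Module.finrank F T') {x : E} (hx : x ∉ Set.range (algebraMap F E)) :
    Module.finrank F ↥(T ⊓ x • T) ≤ 1 := by
  by_contra hcon
  obtain ⟨R', C'⟩ := C.inf_smul h hTR (ne_zero_of_notMem_range hx) (by omega)
  have h1 := C.finrank_add
  have h2 := C.two_le_left
  have h3 := C.two_le_right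
  have hlt := h.finrank_inf_smul_lt hx (ne_bot_of_finrank C.two_le_mid)
    (ne_top_of_finrank (by omega))
  have := hmin _ _ C' fun hg => hT (C.swap.isGeometric_left h (C'.isGeometric_left h hg))
  omega

/-- A space `T` of dimension at least three such that, for independent `u, v ∈ T`, the sums
`uT + vT` and `uT² + vT²` behave as for a pencil of divisors without base points and
`T² = uT + vT`. -/
structure IsRigid (T : Submodule F E) : Prop where
  three_le : 3 ≤ Module.finrank F T
  mul_le : ∀ u ∈ T, u ≠ 0 → ∀ v ∈ T, v ∉ Submodule.span F {u} → T * T ≤ u • T ⊔ v • T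
  inf_le : ∀ u ∈ T, u ≠ 0 → ∀ v ∈ T, v ∉ Submodule.span F {u} →
    u • T ⊓ v • T ≤ Submodule.span F {u * v}
  inf_mul_le : ∀ u ∈ T, u ≠ 0 → ∀ v ∈ T, v ∉ Submodule.span F {u} →
    u • (T * T) ⊓ v • (T * T) ≤ (u * v) • T

/-- T is a non-geometric member of least dimension over all critical triples, and B a partner of T
of least dimension. Both meet their multiples by elements outside F in dimension at most one, and
the dimension inequalities for TB, T²B, T² and T³ then become equalities. -/
theorem exists_isRigid_of_criticalTriple (h : NoIntermediate F E) {S₀ T₀ R₀ : Submodule F E}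
    (C₀ : CriticalTriple S₀ T₀ R₀) (hT₀ : ¬ IsGeometric T₀) :
    ∃ T : Submodule F E, IsRigid T := by
  classical
  have hex : ∃ b, ∃ S T R : Submodule F E, CriticalTriple S T R ∧ ¬ IsGeometric T ∧
    Module.finrank F T = b := ⟨_, S₀, T₀, R₀, C₀, hT₀, rfl⟩
  obtain ⟨S, T, R, C, hT, hb⟩ := Nat.find_spec hex
  have hmin : ∀ S' T' R' : Submodule F E, CriticalTriple S' T' R' → ¬ IsGeometric T' →
      Module.finrank F T ≤ Module.finrank F T' := fun S' T' R' C' hT' =>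
    hb ▸ Nat.find_min' hex ⟨S', T', R', C', hT', rfl⟩
  have hS : ¬ IsGeometric S := fun hg => hT (C.swap.isGeometric_left h hg)
  have hR : ¬ IsGeometric R := fun hg => hS (C.swap_right.isGeometric_left h hg)
  have hTsidon : ∀ x, x ∉ Set.range (algebraMap F E) →
      Module.finrank F ↥(T ⊓ x • T) ≤ 1 := fun x hx =>
    C.finrank_inf_smul_le_one h hT (hmin S R T C.swap_right hR) (hmin S) hx
  have hex' : ∃ b, ∃ B R' : Submodule F E, CriticalTriple T B R' ∧ Module.finrank F B = b :=
    ⟨_, S, R, C.swap, rfl⟩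
  obtain ⟨B, R', C', hb'⟩ := Nat.find_spec hex'
  have hmin' : ∀ B' R'' : Submodule F E, CriticalTriple T B' R'' →
      Module.finrank F B ≤ Module.finrank F B' := fun B' R'' C'' =>
    hb' ▸ Nat.find_min' hex' ⟨B', R'', C'', rfl⟩
  have hB : ¬ IsGeometric B := fun hg => hT (C'.isGeometric_left h hg)
  have hBR := hmin' R' B C'.swap_right
  have hBsidon : ∀ x, x ∉ Set.range (algebraMap F E) →
      Module.finrank F ↥(B ⊓ x • B) ≤ 1 := fun x hx =>
    C'.finrank_inf_smul_le_one h hB hBR (fun B' R'' C'' _ => hmin' B' R'' C'') hx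
  have hTB := hmin T B R' C' hB
  obtain ⟨htop, hmul⟩ := C'.finrank_mul h
  have hadd := C'.finrank_add
  have h2T := C'.two_le_left
  have h2B := C'.two_le_mid
  have hTbot := ne_bot_of_finrank h2T
  have hBbot := ne_bot_of_finrank h2B
  -- uB + vB has dimension at least 2 dim B - 1 but lies in TB, of dimension dim T + dim B - 1;
  -- since dim T ≤ dim B, all are equal.
  have hsumB : ∀ u ∈ T, u ≠ 0 → ∀ v ∈ T, v ∉ Submodule.span F {u} →
      Module.finrank F B = Module.finrank F T ∧ T * B = u • B ⊔ v • B := by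
    intro u hu hu0 v hv hvu
    have h1 := finrank_smul_sup_smul hu0 (ne_zero_of_notMem_span hvu) B
    have h2 := hBsidon _ (div_notMem_range hu0 hvu)
    rw [← finrank_smul_inf_smul hu0] at h2
    have hle := smul_sup_smul_le_mul (B := B) hu hv
    have h3 := Submodule.finrank_mono hle
    exact ⟨by omega, (Submodule.eq_of_le_of_finrank_le hle (by omega)).symm⟩
  obtain ⟨u, hu, hu0⟩ := (Submodule.ne_bot_iff T).1 hTbot
  obtain ⟨v, hv, hvu⟩ := exists_notMem_span h2T u
  obtain ⟨hBT, hTBuv⟩ := hsumB u hu hu0 v hv hvu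
  have hv0 := ne_zero_of_notMem_span hvu
  have hcube : ∀ W : Submodule F E, T * W = u • W ⊔ v • W →
      Module.finrank F ↥(T * (T * W)) + Module.finrank F W ≤ 2 * Module.finrank F ↥(T * W) := by
    intro W hW
    have h1 : T * (T * W) = u • (T * W) ⊔ v • (T * W) := by
      conv_lhs => rw [hW, Submodule.mul_sup, mul_smul_submodule, mul_smul_submodule]
    have h2 := finrank_smul_sup_smul hu0 hv0 (T * W)
    have h3 := Submodule.finrank_mono (mul_smul_le_inf (B := W) hu hv)
    rw [finrank_smul (mul_ne_zero hu0 hv0)] at h3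
    rw [h1]
    omega
  -- With t = dim T = dim B, this gives dim T²B ≤ 3t - 2, below [E : F] because dim B ≤ dim R'.
  -- Cauchy–Davenport for T² and B then yields dim T² ≤ 2t - 1.
  have h1 := hcube B hTBuv
  have h2 := h.finrank_add_le_finrank_mul (T * T) B (mul_ne_bot hTbot hTbot) hBbot
    (by rw [mul_assoc]; exact ne_top_of_finrank (by omega))
  rw [mul_assoc] at h2
  have hsumT : ∀ u ∈ T, u ≠ 0 → ∀ v ∈ T, v ∉ Submodule.span F {u} →
      Module.finrank F ↥(T * T) + 1 = 2 * Module.finrank F T ∧ T * T = u • T ⊔ v • T := by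
    intro u hu hu0 v hv hvu
    have h1 := finrank_smul_sup_smul hu0 (ne_zero_of_notMem_span hvu) T
    have h2 := hTsidon _ (div_notMem_range hu0 hvu)
    rw [← finrank_smul_inf_smul hu0] at h2
    have hle := smul_sup_smul_le_mul (B := T) hu hv
    have h3 := Submodule.finrank_mono hle
    exact ⟨by omega, (Submodule.eq_of_le_of_finrank_le hle (by omega)).symm⟩
  have h3 := hcube T (hsumT u hu hu0 v hv hvu).2
  have h4 := (hsumT u hu hu0 v hv hvu).1
  have h5 := h.finrank_add_le_finrank_mul T (T * T) hTbot (mul_ne_bot hTbot hTbot)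
    (ne_top_of_finrank (by omega))
  refine ⟨T, ?_, ?_, ?_, ?_⟩
  · by_contra hlt
    exact hT (isGeometric_of_finrank_eq_two (by omega))
  · intro u hu hu0 v hv hvu
    exact (hsumT u hu hu0 v hv hvu).2.le
  · intro u hu hu0 v hv hvu
    have h2 := hTsidon _ (div_notMem_range hu0 hvu)
    rw [← finrank_smul_inf_smul hu0] at h2
    have hv0 := ne_zero_of_notMem_span hvu
    refine (Submodule.eq_of_le_of_finrank_le (S₁ := Submodule.span F {u * v}) ?_ ?_).ge
    · rw [Submodule.span_singleton_le_iff_mem]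
      refine ⟨mul_mem_smul hv, ?_⟩
      rw [mul_comm]
      exact mul_mem_smul hu
    · rwa [finrank_span_singleton (mul_ne_zero hu0 hv0)]
  · intro u hu hu0 v hv hvu
    have hv0 := ne_zero_of_notMem_span hvu
    refine (Submodule.eq_of_le_of_finrank_le (mul_smul_le_inf hu hv) ?_).ge
    rw [finrank_smul (mul_ne_zero hu0 hv0)]
    have h6 := finrank_smul_sup_smul hu0 hv0 (T * T)
    have h7 : T * (T * T) = u • (T * T) ⊔ v • (T * T) := by
      conv_lhs => rw [(hsumT u hu hu0 v hv hvu).2, Submodule.mul_sup, mul_smul_submodule,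
        mul_smul_submodule]
    rw [← h7] at h6
    omega

end Critical

/-! ### Points of a space with quadratic relations. -/

section Points

variable {F E : Type*} [Field F] [Field E] [Algebra F E]

/-- A `K`-valued point of `T`: a linear map `T → K` that respects all three-term quadratic
relations between elements of `T`. -/
def IsPoint {T : Submodule F E} {K : Type*} [CommRing K] [Algebra F K] (p : T →ₗ[F] K) : Prop :=
  ∀ x y u w v z : T, (x * y : E) = u * w + v * z → p x * p y = p u * p w + p v * p z

theorem IsPoint.comp {T : Submodule F E} {K L : Type*} [CommRing K] [Algebra F K] [CommRing L]
    [Algebra F L] {p : T →ₗ[F] K} (hp : IsPoint p) (φ : K →ₐ[F] L) :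
    IsPoint (φ.toLinearMap ∘ₗ p) := by
  intro x y u w v z h
  simpa using congrArg φ (hp x y u w v z h)

theorem IsPoint.smul {T : Submodule F E} {K : Type*} [CommRing K] [Algebra F K]
    {p : T →ₗ[F] K} (hp : IsPoint p) (c : K) : IsPoint (c • p) := by
  intro x y u w v z h
  simp only [LinearMap.smul_apply, smul_eq_mul]
  linear_combination c ^ 2 * hp x y u w v z h

/-- Distinct points with the same values on `u` and `v` are linearly independent when
`T² = uT + vT`. -/
theorem IsPoint.eq_zero_of_sum_eq_zero {T : Submodule F E} {K : Type*} [Field K] [Algebra F K]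
    {u v : T} (hT : ∀ x y : T, ∃ w z : T, (x * y : E) = u * w + v * z)
    {α β : K} (hαβ : α ≠ 0 ∨ β ≠ 0) (s : Finset (T →ₗ[F] K))
    (hs : ∀ p ∈ s, IsPoint p ∧ p u = α ∧ p v = β) (c : (T →ₗ[F] K) → K)
    (hc : ∑ p ∈ s, c p • p = 0) : ∀ p ∈ s, c p = 0 := by
  classical
  induction s using Finset.induction_on generalizing c with
  | empty => simp
  | insert a s ha IH =>
    have hc1 : ∀ y : T, ∑ p ∈ insert a s, c p * p y = 0 := fun y => by
      simpa using LinearMap.congr_fun hc y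
    -- As in Dedekind's independence of characters, the relation may be multiplied by p x: writing
    -- xy = uw + vz, the common values α, β turn p x * p y into α p w + β p z.
    have hc2 : ∀ x y : T, ∑ p ∈ insert a s, c p * (p x * p y) = 0 := by
      intro x y
      obtain ⟨w, z, hwz⟩ := hT x y
      have : ∀ p ∈ insert a s, c p * (p x * p y) = α * (c p * p w) + β * (c p * p z) := by
        intro p hp
        obtain ⟨h1, h2, h3⟩ := hs p hp
        rw [h1 x y u w v z hwz, h2, h3]
        ring
      rw [Finset.sum_congr rfl this, Finset.sum_add_distrib, ← Finset.mul_sum, ← Finset.mul_sum,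
        hc1, hc1, mul_zero, mul_zero, add_zero]
    have hs0 : ∀ p ∈ s, c p = 0 := by
      intro p hp
      have hpa : p ≠ a := fun e => ha (e ▸ hp)
      obtain ⟨x, hx⟩ : ∃ x, p x ≠ a x := by
        by_contra! hcon
        exact hpa (LinearMap.ext hcon)
      have := IH (fun p hp => hs p (Finset.mem_insert_of_mem hp)) (fun p => c p * (p x - a x)) (by
        ext y
        have h1 := hc2 x y
        have h2 := hc1 y
        rw [Finset.sum_insert ha] at h1 h2
        simp only [LinearMap.sum_apply, LinearMap.smul_apply, smul_eq_mul, LinearMap.zero_apply]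
        have h3 : ∑ p ∈ s, c p * (p x - a x) * p y =
            ∑ p ∈ s, c p * (p x * p y) - a x * ∑ p ∈ s, c p * p y := by
          rw [Finset.mul_sum, ← Finset.sum_sub_distrib]
          exact Finset.sum_congr rfl fun p _ => by ring
        rw [h3]
        linear_combination h1 - a x * h2) p hp
      exact (mul_eq_zero.1 this).resolve_right (sub_ne_zero.2 hx)
    have hca : c a = 0 := by
      rw [Finset.sum_insert ha, Finset.sum_eq_zero (fun p hp => by rw [hs0 p hp, zero_smul]),
        add_zero] at hc
      refine (smul_eq_zero.1 hc).resolve_right fun h0 => ?_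
      obtain ⟨-, h2, h3⟩ := hs a (Finset.mem_insert_self _ _)
      rw [h0, LinearMap.zero_apply] at h2 h3
      rcases hαβ with h | h
      · exact h h2.symm
      · exact h h3.symm
    intro p hp
    rcases Finset.mem_insert.1 hp with rfl | hp
    · exact hca
    · exact hs0 p hp

theorem exists_linearMap_ne_zero_of_notMem {V : Type*} [AddCommGroup V] [Module F V] {u v : V}
    (K : Type*) [Field K] [Algebra F K] (hv : v ∉ Submodule.span F {u}) :
    ∃ f : V →ₗ[F] K, f v ≠ 0 ∧ f u = 0 := by
  obtain ⟨f, hf, hle⟩ := Submodule.exists_le_ker_of_notMem hv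
  refine ⟨Algebra.linearMap F K ∘ₗ f, ?_, ?_⟩
  · simpa using hf
  · have : f u = 0 := hle (Submodule.mem_span_singleton_self u)
    simp [this]

/-- At most `dim T - 1` points take given values on `u` and `v` when `T² = uT + vT`. -/
theorem IsPoint.card_add_one_le {T : Submodule F E} [FiniteDimensional F T] {K : Type*} [Field K]
    [Algebra F K] {u v : T} (hT : ∀ x y : T, ∃ w z : T, (x * y : E) = u * w + v * z)
    (huv : v ∉ Submodule.span F {u}) (hvu : u ∉ Submodule.span F {v})
    {α β : K} (hαβ : α ≠ 0 ∨ β ≠ 0) (s : Finset (T →ₗ[F] K))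
    (hs : ∀ p ∈ s, IsPoint p ∧ p u = α ∧ p v = β) :
    s.card + 1 ≤ Module.finrank F T := by
  -- All the points in question lie in the hyperplane β p(u) = α p(v) of Hom(T, K), whose dimension
  -- is dim T - 1.
  let ev : (T →ₗ[F] K) →ₗ[K] K :=
    { toFun := fun p => β * p u - α * p v
      map_add' := fun p q => by simp only [LinearMap.add_apply]; ring
      map_smul' := fun c p => by
        simp only [LinearMap.smul_apply, smul_eq_mul, RingHom.id_apply]; ring }
  have hev : ev ≠ 0 := by
    intro h0
    have h1 : ∀ p : T →ₗ[F] K, β * p u - α * p v = 0 := fun p => LinearMap.congr_fun h0 p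
    rcases hαβ with h | h
    · obtain ⟨f, hf1, hf2⟩ := exists_linearMap_ne_zero_of_notMem K huv
      have := h1 f
      rw [hf2, mul_zero, zero_sub, neg_eq_zero, mul_eq_zero] at this
      exact this.elim h hf1
    · obtain ⟨f, hf1, hf2⟩ := exists_linearMap_ne_zero_of_notMem K hvu
      have := h1 f
      rw [hf2, mul_zero, sub_zero, mul_eq_zero] at this
      exact this.elim h hf1
  have hker := Module.Dual.finrank_ker_add_one_of_ne_zero hev
  rw [Module.finrank_linearMap_self] at hker
  have hli : LinearIndependent K (fun p : s => (p : T →ₗ[F] K)) := by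
    rw [linearIndependent_iff']
    intro t c hc p hp
    classical
    have key := IsPoint.eq_zero_of_sum_eq_zero hT hαβ (t.image Subtype.val)
      (by
        intro p hp
        obtain ⟨q, -, rfl⟩ := Finset.mem_image.1 hp
        exact hs _ q.2)
      (fun p => if h : p ∈ s then c ⟨p, h⟩ else 0)
      (by
        rw [Finset.sum_image Subtype.val_injective.injOn, ← hc]
        exact Finset.sum_congr rfl fun q _ => by simp)
      p (Finset.mem_image_of_mem _ hp)
    simpa using key
  have hmem : ∀ p : s, (p : T →ₗ[F] K) ∈ LinearMap.ker ev := by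
    intro p
    obtain ⟨-, h2, h3⟩ := hs p p.2
    change β * _ - α * _ = 0
    rw [h2, h3]
    ring
  have hli' : LinearIndependent K (fun p : s => (⟨p, hmem p⟩ : LinearMap.ker ev)) :=
    LinearIndependent.of_comp (LinearMap.ker ev).subtype hli
  have := hli'.fintype_card_le_finrank
  rw [Fintype.card_coe] at this
  omega

end Points

/-! ### The residue field at a nonzero element of a rigid space. -/

section Field

universe u

variable {F : Type*} {E : Type u} [Field F] [Finite F] [Field E] [Algebra F E]
  [FiniteDimensional F E]

/-- Modulo u, division by v makes sense: x acts on T / ⟨u⟩ as multiplication by x / v. These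
operators form a finite algebra without zero divisors, hence a field, and x ↦ x / v is the point. -/
theorem IsRigid.exists_isPoint {T : Submodule F E} (hT : IsRigid T) {u : T} (hu : u ≠ 0) :
    ∃ (K : Type u) (_ : Field K) (_ : Algebra F K) (p : T →ₗ[F] K),
      Function.Surjective p ∧ LinearMap.ker p = Submodule.span F {u} ∧ IsPoint p := by
  have hu0 : (u : E) ≠ 0 := fun e => hu (Subtype.ext e)
  set N : Submodule F T := Submodule.span F {u} with hN
  have hspan : ∀ x : T, x ∉ N → (x : E) ∉ Submodule.span F {(u : E)} := by
    intro x hx hmem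
    obtain ⟨c, hc⟩ := Submodule.mem_span_singleton.1 hmem
    exact hx (Submodule.mem_span_singleton.2 ⟨c, Subtype.ext hc⟩)
  obtain ⟨v, hv⟩ : ∃ v : T, v ∉ N := by
    obtain ⟨v, hv, hvu⟩ := exists_notMem_span ((Nat.le_succ 2).trans hT.three_le) (u : E)
    refine ⟨⟨v, hv⟩, fun hmem => hvu ?_⟩
    obtain ⟨c, hc⟩ := Submodule.mem_span_singleton.1 hmem
    exact Submodule.mem_span_singleton.2 ⟨c, congrArg Subtype.val hc⟩
  set D : Submodule F E := (u : E) • T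
  have hD : ∀ x : T, (u * x : E) ∈ D := fun x => mul_mem_smul x.2
  have hD' : ∀ y ∈ D, ∃ x : T, y = u * x := by
    intro y hy
    obtain ⟨w, hw, rfl⟩ := (Submodule.mem_smul_pointwise_iff_exists _ _ _).1 hy
    exact ⟨⟨w, hw⟩, rfl⟩
  -- cancellation modulo `u`
  have hcancel : ∀ x m : T, x ∉ N → (x * m : E) ∈ D → m ∈ N := by
    intro x m hx hm
    have h1 := hT.inf_le u u.2 hu0 x x.2 (hspan x hx) ⟨hm, mul_mem_smul m.2⟩
    obtain ⟨c, hc⟩ := Submodule.mem_span_singleton.1 h1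
    have hx0 : (x : E) ≠ 0 := ne_zero_of_notMem_span (hspan x hx)
    refine Submodule.mem_span_singleton.2 ⟨c, Subtype.ext (mul_left_cancel₀ hx0 ?_)⟩
    rw [← hc, Submodule.coe_smul, mul_smul_comm, mul_comm (x : E)]
  have hcancel2 : ∀ m : T, (v * (v * m) : E) ∈ (u : E) • (T * T) → m ∈ N := by
    intro m hm
    have h1 := hT.inf_mul_le u u.2 hu0 v v.2 (hspan v hv)
      ⟨hm, mul_mem_smul (Submodule.mul_mem_mul v.2 m.2)⟩
    obtain ⟨w, hw, hw'⟩ := (Submodule.mem_smul_pointwise_iff_exists _ _ _).1 h1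
    have hv0 : (v : E) ≠ 0 := ne_zero_of_notMem_span (hspan v hv)
    have h2 : (v * m : E) = u * w := by
      apply mul_left_cancel₀ hv0
      rw [← hw', smul_eq_mul]
      ring
    exact hcancel v m hv (h2 ▸ mul_mem_smul hw)
  have hex : ∀ x m : T, ∃ w z : T, (x * m : E) = u * w + v * z := by
    intro x m
    have := hT.mul_le u u.2 hu0 v v.2 (hspan v hv) (Submodule.mul_mem_mul x.2 m.2)
    obtain ⟨a, ha, b, hb, hab⟩ := Submodule.mem_sup.1 this
    obtain ⟨w, hw, rfl⟩ := (Submodule.mem_smul_pointwise_iff_exists _ _ _).1 ha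
    obtain ⟨z, hz, rfl⟩ := (Submodule.mem_smul_pointwise_iff_exists _ _ _).1 hb
    exact ⟨⟨w, hw⟩, ⟨z, hz⟩, hab.symm⟩
  let B₀ : T →ₗ[F] T →ₗ[F] (E ⧸ D) :=
    ((LinearMap.mul F E).compr₂ D.mkQ).domRestrict₁₂ T T
  have hB₀ : ∀ x m : T, B₀ x m = D.mkQ (x * m) := fun _ _ => rfl
  have hle : N ≤ LinearMap.ker B₀.flip := by
    rw [hN, Submodule.span_singleton_le_iff_mem, LinearMap.mem_ker]
    ext x
    rw [LinearMap.flip_apply, hB₀, LinearMap.zero_apply, Submodule.mkQ_apply,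
      Submodule.Quotient.mk_eq_zero, mul_comm]
    exact hD x
  let M : T →ₗ[F] (T ⧸ N) →ₗ[F] (E ⧸ D) := (N.liftQ B₀.flip hle).flip
  have hM : ∀ x m : T, M x (N.mkQ m) = D.mkQ (x * m) := fun _ _ => rfl
  have hMinj : ∀ x : T, x ∉ N → LinearMap.ker (M x) = ⊥ := by
    intro x hx
    rw [LinearMap.ker_eq_bot']
    intro m' hm'
    obtain ⟨m, rfl⟩ := N.mkQ_surjective m'
    rw [hM, Submodule.mkQ_apply, Submodule.Quotient.mk_eq_zero] at hm'
    rw [Submodule.mkQ_apply, Submodule.Quotient.mk_eq_zero]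
    exact hcancel x m hx hm'
  -- The left inverse g is division by v; since xm = uw + vz, each `M x` has image inside that of `M
  -- v`, so the choice of g off that image is harmless.
  obtain ⟨g, hg⟩ := LinearMap.exists_leftInverse_of_injective (M v) (hMinj v hv)
  have hg' : ∀ m, g (M v m) = m := fun m => LinearMap.congr_fun hg m
  let L : T →ₗ[F] Module.End F (T ⧸ N) := M.compr₂ g
  have hL : ∀ x m, L x m = g (M x m) := fun _ _ => rfl
  have hML : ∀ x m, M v (L x m) = M x m := by
    intro x m'
    obtain ⟨m, rfl⟩ := N.mkQ_surjective m'
    obtain ⟨w, z, hwz⟩ := hex x m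
    have : M x (N.mkQ m) = M v (N.mkQ z) := by
      rw [hM, hM, hwz, map_add, add_eq_right, Submodule.mkQ_apply, Submodule.Quotient.mk_eq_zero]
      exact hD w
    rw [hL, this, hg']
  have hLv : L v = 1 := LinearMap.ext fun m => hg' m
  have hLu : ∀ x ∈ N, L x = 0 := by
    intro x hx
    obtain ⟨c, rfl⟩ := Submodule.mem_span_singleton.1 hx
    ext m
    rw [LinearMap.comp_apply, map_smul, LinearMap.smul_apply, hL, hM]
    rw [Submodule.mkQ_apply, (Submodule.Quotient.mk_eq_zero D).2 (hD m)]
    simp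
  have hLinj : ∀ x : T, x ∉ N → ∀ m, L x m = 0 → m = 0 := by
    intro x hx m hm
    have := hML x m
    rw [hm, map_zero] at this
    exact LinearMap.ker_eq_bot'.1 (hMinj x hx) m this.symm
  have hL1 : ∀ x m : T, ∃ m' : T, L x (N.mkQ m) = N.mkQ m' ∧
      ∃ t : T, (x * m : E) = v * m' + u * t := by
    intro x m
    obtain ⟨m', hm'⟩ := N.mkQ_surjective (L x (N.mkQ m))
    refine ⟨m', hm'.symm, ?_⟩
    have h1 := hML x (N.mkQ m)
    rw [← hm', hM, hM, eq_comm, ← sub_eq_zero, ← map_sub, Submodule.mkQ_apply,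
      Submodule.Quotient.mk_eq_zero] at h1
    obtain ⟨t, ht⟩ := hD' _ h1
    exact ⟨t, by rw [← ht]; ring⟩
  have hL2 : ∀ x y m : T, ∃ m' : T, L x (L y (N.mkQ m)) = N.mkQ m' ∧
      ∃ t ∈ T * T, (x * y * m : E) = v * (v * m') + u * t := by
    intro x y m
    obtain ⟨m₁, h1, t₁, ht₁⟩ := hL1 y m
    obtain ⟨m₂, h2, t₂, ht₂⟩ := hL1 x m₁
    refine ⟨m₂, by rw [h1, h2], x * t₁ + v * t₂,
      add_mem (Submodule.mul_mem_mul x.2 t₁.2) (Submodule.mul_mem_mul v.2 t₂.2), ?_⟩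
    linear_combination (x : E) * ht₁ + (v : E) * ht₂
  have hLpt : ∀ x y a w b z : T, (x * y : E) = a * w + b * z →
      L x * L y = L a * L w + L b * L z := by
    intro x y a w b z h
    refine LinearMap.ext fun m' => ?_
    obtain ⟨m, rfl⟩ := N.mkQ_surjective m'
    obtain ⟨m₀, h0, t₀, ht₀, e₀⟩ := hL2 x y m
    obtain ⟨m₁, h1, t₁, ht₁, e₁⟩ := hL2 a w m
    obtain ⟨m₂, h2, t₂, ht₂, e₂⟩ := hL2 b z m
    rw [LinearMap.add_apply, Module.End.mul_apply, Module.End.mul_apply, Module.End.mul_apply,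
      h0, h1, h2, ← map_add, ← sub_eq_zero, ← map_sub, Submodule.mkQ_apply,
      Submodule.Quotient.mk_eq_zero]
    -- Composing two operators costs a factor v², so cancelling it modulo u needs the intersection
    -- condition on T² as well as the one on T.
    apply hcancel2
    have : (v * (v * ((m₀ - (m₁ + m₂) : T) : E)) : E) = u * (t₁ + t₂ - t₀) := by
      push_cast
      linear_combination (m : E) * h - e₀ + e₁ + e₂
    rw [this]
    exact mul_mem_smul (sub_mem (add_mem ht₁ ht₂) ht₀)
  let A : Subalgebra F (Module.End F (T ⧸ N)) :=
    (LinearMap.range L).toSubalgebra ⟨v, hLv⟩ (by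
      rintro _ _ ⟨x, rfl⟩ ⟨y, rfl⟩
      obtain ⟨w, z, hwz⟩ := hex x y
      refine ⟨z, ?_⟩
      rw [hLpt x y u w v z hwz, hLv, hLu u (Submodule.mem_span_singleton_self u), zero_mul,
        one_mul, zero_add])
  have hmemA : ∀ x, L x ∈ A := fun x => ⟨x, rfl⟩
  have hVne : N.mkQ v ≠ 0 := by
    rwa [Submodule.mkQ_apply, Ne, Submodule.Quotient.mk_eq_zero]
  have hLker : ∀ x, L x = 0 → x ∈ N := by
    intro x hx
    by_contra hxN
    exact hVne (hLinj x hxN _ (by rw [hx, LinearMap.zero_apply]))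
  have : Nontrivial A := ⟨⟨0, 1, fun h => hVne (by
    have := LinearMap.congr_fun (congrArg Subtype.val h) (N.mkQ v)
    exact this.symm)⟩⟩
  have : NoZeroDivisors A := ⟨by
    rintro ⟨_, x, rfl⟩ ⟨b, hb⟩ hab
    by_cases hx : x ∈ N
    · exact Or.inl (Subtype.ext (hLu x hx))
    · refine Or.inr (Subtype.ext (LinearMap.ext fun m => hLinj x hx _ ?_))
      exact LinearMap.congr_fun (congrArg Subtype.val hab) m⟩
  have : IsDomain A := NoZeroDivisors.to_isDomain A
  have : Finite E := Module.finite_of_finite F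
  have : Finite (T ⧸ N) := Finite.of_surjective _ N.mkQ_surjective
  have : Finite (Module.End F (T ⧸ N)) := DFunLike.finite _
  have : Finite A := Subtype.finite
  -- Wedderburn's little theorem for a finite domain supplies commutativity and inverses together.
  let _ : Field A := (Finite.isDomain_to_isField A).toField
  refine ⟨A, inferInstance, (inferInstance : Algebra F A),
    L.codRestrict (Subalgebra.toSubmodule A) hmemA, ?_, ?_, ?_⟩
  · rintro ⟨_, x, rfl⟩
    exact ⟨x, rfl⟩
  · ext x
    rw [LinearMap.mem_ker]
    exact ⟨fun h => hLker x (congrArg Subtype.val h), fun h => Subtype.ext (hLu x h)⟩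
  · intro x y a w b z h
    exact Subtype.ext (hLpt x y a w b z h)

end Field

/-! ### The point count that excludes rigid spaces, and Vosper's theorem. -/

section Vosper

variable {F E : Type*} [Field F] [Finite F] [Field E] [Algebra F E] [FiniteDimensional F E]

/-- The points of a rigid space with a given kernel, normalised at `u₀, v₀`, and with values in a
field of the right size: there are at least `dim T - 1` of them. -/
theorem IsRigid.exists_injective_points {T : Submodule F E} (hT : IsRigid T) {K : Type*} [Field K]
    [Finite K] [Algebra F K] (hK : Module.finrank F K + 1 = Module.finrank F T) {u₀ v₀ : T}
    (hu₀ : u₀ ≠ 0) (h0 : v₀ ∉ Submodule.span F {u₀}) {u : T} (hu : u ≠ 0) :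
    ∃ f : Fin (Module.finrank F K) → (T →ₗ[F] K), Function.Injective f ∧
      ∀ i, LinearMap.ker (f i) = Submodule.span F {u} ∧ IsPoint (f i) ∧
        (f i v₀ = 1 ∨ f i u₀ = 1 ∧ f i v₀ = 0) := by
  obtain ⟨K', _, _, p, hsurj, hker, hp⟩ := hT.exists_isPoint hu
  have hrank := LinearMap.finrank_range_add_finrank_ker p
  rw [LinearMap.range_eq_top.2 hsurj, finrank_top, hker, finrank_span_singleton hu] at hrank
  have hKK : Module.finrank F K' = Module.finrank F K := by omega
  -- The kernel of p is a line, so u₀ and v₀ cannot both lie in it; scaling picks a representative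
  -- of (p u₀ : p v₀) in P¹.
  obtain ⟨c, hc, hnorm⟩ : ∃ c : K', c ≠ 0 ∧ (c * p v₀ = 1 ∨ c * p u₀ = 1 ∧ c * p v₀ = 0) := by
    by_cases hv : p v₀ = 0
    · by_cases hu' : p u₀ = 0
      · exfalso
        have hu0 : u₀ ∈ Submodule.span F {u} := by rw [← hker]; exact hu'
        have hv0 : v₀ ∈ Submodule.span F {u} := by rw [← hker]; exact hv
        obtain ⟨a, ha⟩ := Submodule.mem_span_singleton.1 hu0
        obtain ⟨b, hb⟩ := Submodule.mem_span_singleton.1 hv0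
        have ha0 : a ≠ 0 := by
          rintro rfl
          exact hu₀ (by rw [← ha, zero_smul])
        refine h0 (Submodule.mem_span_singleton.2 ⟨b * a⁻¹, ?_⟩)
        rw [← ha, ← hb, smul_smul, inv_mul_cancel_right₀ ha0]
      · exact ⟨(p u₀)⁻¹, inv_ne_zero hu', Or.inr ⟨inv_mul_cancel₀ hu', by rw [hv, mul_zero]⟩⟩
    · exact ⟨(p v₀)⁻¹, inv_ne_zero hv, Or.inl (inv_mul_cancel₀ hv)⟩
  -- Finite extensions of F of equal degree d have exactly d embeddings over F; composing p with
  -- them gives the d conjugate points.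
  have hcard := FiniteField.natCard_algHom_of_finrank_dvd (F := F) (K := K') (L := K) hKK.dvd
  have : Finite (K' →ₐ[F] K) := Nat.finite_of_card_ne_zero (by
    have := hT.three_le
    omega)
  have e : Fin (Module.finrank F K) ≃ (K' →ₐ[F] K) :=
    (Finite.equivFinOfCardEq (hcard.trans hKK)).symm
  refine ⟨fun i => (e i).toLinearMap ∘ₗ (c • p), ?_, fun i => ⟨?_, (hp.smul c).comp _, ?_⟩⟩
  · intro i j hij
    refine e.injective (AlgHom.ext fun y => ?_)
    obtain ⟨x, hx⟩ := hsurj (c⁻¹ * y)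
    have := LinearMap.congr_fun hij x
    simpa [hx, mul_inv_cancel_left₀ hc] using this
  · rw [← hker]
    ext x
    simp [hc]
  · rcases hnorm with h | ⟨h, h'⟩
    · left
      simpa using congrArg (e i) h
    · right
      exact ⟨by simpa using congrArg (e i) h, by simpa using congrArg (e i) h'⟩

theorem geom_sum_gt {q d : ℕ} (hq : 1 ≤ q) (hd : 2 ≤ d) :
    q ^ d + 1 < ∑ i ∈ Finset.range (d + 1), q ^ i := by
  obtain ⟨e, rfl⟩ : ∃ e, d = e + 2 := ⟨d - 2, by omega⟩
  rw [Finset.sum_range_succ, Finset.sum_range_succ]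
  have h1 : 1 ≤ q ^ (e + 1) := Nat.one_le_pow _ _ hq
  have h2 : 1 ≤ ∑ i ∈ Finset.range (e + 1), q ^ i := by
    rw [Finset.sum_range_succ']
    simp
  omega

/-- Double count of normalised points over K = F_{q^d}, d = dim T - 1: at least d for each of the 1
+ q + ⋯ + q^d lines of T, by kernel, and at most d for each of the q^d + 1 values at (u₀, v₀). -/
theorem not_isRigid (T : Submodule F E) : ¬ IsRigid T := by
  classical
  intro hT
  have h3 := hT.three_le
  have : Finite E := Module.finite_of_finite F
  obtain ⟨u₁, hu₁, hne⟩ := (Submodule.ne_bot_iff T).1 (ne_bot_of_finrank (by omega))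
  obtain ⟨v₁, hv₁, hvu₁⟩ := exists_notMem_span (by omega : 2 ≤ Module.finrank F T) u₁
  set u₀ : T := ⟨u₁, hu₁⟩
  set v₀ : T := ⟨v₁, hv₁⟩
  have hu₀ : u₀ ≠ 0 := fun e => hne (congrArg Subtype.val e)
  have hv₀ : v₀ ∉ Submodule.span F {u₀} := by
    intro hmem
    obtain ⟨c, hc⟩ := Submodule.mem_span_singleton.1 hmem
    exact hvu₁ (Submodule.mem_span_singleton.2 ⟨c, congrArg Subtype.val hc⟩)
  have huv₀ : u₀ ∉ Submodule.span F {v₀} := by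
    intro hmem
    obtain ⟨c, hc⟩ := Submodule.mem_span_singleton.1 hmem
    have hc0 : c ≠ 0 := by
      rintro rfl
      exact hu₀ (by rw [← hc, zero_smul])
    exact hv₀ (Submodule.mem_span_singleton.2 ⟨c⁻¹, by rw [← hc, inv_smul_smul₀ hc0]⟩)
  have hex : ∀ x y : T, ∃ w z : T, (x * y : E) = u₀ * w + v₀ * z := by
    intro x m
    have := hT.mul_le u₁ hu₁ hne v₁ hv₁ hvu₁ (Submodule.mul_mem_mul x.2 m.2)
    obtain ⟨a, ha, b, hb, hab⟩ := Submodule.mem_sup.1 this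
    obtain ⟨w, hw, rfl⟩ := (Submodule.mem_smul_pointwise_iff_exists _ _ _).1 ha
    obtain ⟨z, hz, rfl⟩ := (Submodule.mem_smul_pointwise_iff_exists _ _ _).1 hb
    exact ⟨⟨w, hw⟩, ⟨z, hz⟩, hab.symm⟩
  obtain ⟨K, _, _, p, hsurj, hker, -⟩ := hT.exists_isPoint hu₀
  have hrank := LinearMap.finrank_range_add_finrank_ker p
  rw [LinearMap.range_eq_top.2 hsurj, finrank_top, hker, finrank_span_singleton hu₀] at hrank
  have : Finite K := Finite.of_surjective _ hsurj
  have : Finite (T →ₗ[F] K) := DFunLike.finite _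
  have := Fintype.ofFinite K
  have := Fintype.ofFinite (T →ₗ[F] K)
  set X : Finset (T →ₗ[F] K) :=
    Finset.univ.filter fun p => IsPoint p ∧ (p v₀ = 1 ∨ p u₀ = 1 ∧ p v₀ = 0) with hX
  set d := Module.finrank F K with hd
  have hupper : X.card ≤ d * (Fintype.card K + 1) := by
    let val : (T →ₗ[F] K) → K × K := fun p => (p u₀, p v₀)
    have himage : (X.image val).card ≤ Fintype.card K + 1 := by
      have hsub : X.image val ⊆ insert (1, 0) (Finset.univ.image fun a : K => (a, (1 : K))) := by
        intro y hy
        obtain ⟨p, hp, rfl⟩ := Finset.mem_image.1 hy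
        rcases (Finset.mem_filter.1 hp).2.2 with h | ⟨h, h'⟩
        · exact Finset.mem_insert_of_mem
            (Finset.mem_image.2 ⟨p u₀, Finset.mem_univ _, Prod.ext rfl h.symm⟩)
        · exact Finset.mem_insert.2 (Or.inl (Prod.ext h h'))
      refine (Finset.card_le_card hsub).trans ((Finset.card_insert_le _ _).trans ?_)
      exact Nat.succ_le_succ Finset.card_image_le
    refine (Finset.card_le_mul_card_image (f := val) X d fun b hb => ?_).trans
      (Nat.mul_le_mul_left d himage)
    obtain ⟨p, hp, rfl⟩ := Finset.mem_image.1 hb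
    have hne' : p u₀ ≠ 0 ∨ p v₀ ≠ 0 := by
      rcases (Finset.mem_filter.1 hp).2.2 with h | ⟨h, -⟩
      · exact Or.inr (h ▸ one_ne_zero)
      · exact Or.inl (h ▸ one_ne_zero)
    have := IsPoint.card_add_one_le hex hv₀ huv₀ hne' (X.filter fun a => val a = val p)
      fun q hq => by
        obtain ⟨hqX, hq⟩ := Finset.mem_filter.1 hq
        exact ⟨(Finset.mem_filter.1 hqX).2.1, congrArg Prod.fst hq, congrArg Prod.snd hq⟩
    omega
  have hlower : Nat.card (Projectivization F T) * d ≤ X.card := by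
    choose f hf hf' using fun P : Projectivization F T =>
      hT.exists_injective_points (K := K) (by omega) hu₀ hv₀ P.rep_nonzero
    let g : Projectivization F T × Fin d → X := fun a =>
      ⟨f a.1 a.2, Finset.mem_filter.2 ⟨Finset.mem_univ _, (hf' a.1 a.2).2⟩⟩
    have hg : Function.Injective g := by
      rintro ⟨P, i⟩ ⟨Q, j⟩ h
      have h' : f P i = f Q j := congrArg Subtype.val h
      have hPQ : P = Q := by
        apply Projectivization.submodule_injective
        rw [Projectivization.submodule_eq, Projectivization.submodule_eq, ← (hf' P i).1, h',
          (hf' Q j).1]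
      subst hPQ
      rw [hf P h']
    have := Nat.card_le_card_of_injective g hg
    rwa [Nat.card_prod, Nat.card_fin, Nat.card_eq_fintype_card (α := X), Fintype.card_coe] at this
  rw [Projectivization.card_of_finrank F T hrank.symm, mul_comm] at hlower
  have hKcard : Fintype.card K = Nat.card F ^ d := by
    rw [← Nat.card_eq_fintype_card, Module.natCard_eq_pow_finrank (K := F)]
  have hgt := geom_sum_gt (q := Nat.card F) (d := d) Nat.card_pos (by omega)
  rw [hKcard] at hupper
  have := Nat.le_of_mul_le_mul_left (hlower.trans hupper) (by omega)
  omega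

/-- The linear analogue of Vosper's theorem for finite fields. -/
theorem NoIntermediate.vosper (h : NoIntermediate F E) {S T : Submodule F E}
    (hS : 2 ≤ Module.finrank F S) (hT : 2 ≤ Module.finrank F T)
    (hST : Module.finrank F ↥(S * T) + 1 ≤ Module.finrank F S + Module.finrank F T)
    (hn : Module.finrank F ↥(S * T) + 2 ≤ Module.finrank F E) :
    ∃ g g' x : E, x ∉ Set.range (algebraMap F E) ∧ g ≠ 0 ∧ g' ≠ 0 ∧
      S = g • powerSpan F x (Module.finrank F S) ∧ T = g' • powerSpan F x (Module.finrank F T) := by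
  obtain ⟨R, C⟩ := CriticalTriple.of_finrank_mul h hS hT hST hn
  obtain ⟨x, hx, hxT⟩ : IsGeometric T := by
    by_contra hcon
    obtain ⟨T', hT'⟩ := exists_isRigid_of_criticalTriple h C hcon
    exact not_isRigid T' hT'
  have h1 := C.finrank_add
  have h2 := C.two_le_right
  obtain ⟨g', hg', hT'⟩ := h.eq_smul_powerSpan hx (ne_bot_of_finrank hT)
    (ne_top_of_finrank (by omega)) hxT
  obtain ⟨g, hg, hS'⟩ := h.eq_smul_powerSpan hx (ne_bot_of_finrank hS)
    (ne_top_of_finrank (by omega)) (C.finrank_sup_smul_le h hx hxT)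
  exact ⟨g, g', x, hx, hg, hg', hS', hT'⟩

end Vosper

/-! ### The quotient S / T and its extremal dimension. -/

section Quotients

variable {F E : Type*} [Field F] [Field E] [Algebra F E]

theorem noIntermediate_of_prime (hn : (Module.finrank F E).Prime) : NoIntermediate F E := by
  intro x hx
  have := Subalgebra.isSimpleOrder_of_finrank_prime F E hn
  refine (eq_bot_or_eq_top (Algebra.adjoin F {x})).resolve_left fun h => hx ?_
  rw [← Algebra.mem_bot, ← h]
  exact Algebra.self_mem_adjoin_singleton F x

/-- The condition xt ∈ S is linear in t, so it suffices to test it on generators of the span. -/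
theorem iInf_inv_smul_eq_div {ι : Type*} {a : ι → E} (ha : ∀ i, a i ≠ 0) (S : Submodule F E) :
    ⨅ i, (a i)⁻¹ • S = S / Submodule.span F (Set.range a) := by
  ext x
  rw [Submodule.mem_iInf, Submodule.mem_div_iff_forall_mul_mem]
  constructor
  · intro h t ht
    induction ht using Submodule.span_induction with
    | mem t ht =>
      obtain ⟨i, rfl⟩ := ht
      have := h i
      rwa [mem_smul_iff (inv_ne_zero (ha i)), inv_inv, mul_comm] at this
    | zero => simp
    | add s t _ _ hs ht => rw [mul_add]; exact add_mem hs ht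
    | smul c t _ ht => rw [mul_smul_comm]; exact Submodule.smul_mem _ c ht
  · intro h i
    rw [mem_smul_iff (inv_ne_zero (ha i)), inv_inv, mul_comm]
    exact h _ (Submodule.subset_span ⟨i, rfl⟩)

theorem div_mul_le (S T : Submodule F E) : S / T * T ≤ S :=
  Submodule.mul_le.2 fun _ hx _ ht => Submodule.mem_div_iff_forall_mul_mem.1 hx _ ht

theorem smul_powerSpan_mul_smul_powerSpan_le (g g' x : E) (a b : ℕ) :
    g • powerSpan F x a * g' • powerSpan F x b ≤ (g * g') • powerSpan F x (a + b - 1) := by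
  rw [smul_mul_submodule, mul_smul_submodule, smul_smul_submodule]
  exact Submodule.map_mono (powerSpan_mul_le x a b)

variable [FiniteDimensional F E]

theorem NoIntermediate.finrank_div_add_le (h : NoIntermediate F E) {S T : Submodule F E}
    (hS : S ≠ ⊤) (hT : T ≠ ⊥) (hTS : Module.finrank F T ≤ Module.finrank F S + 1) :
    Module.finrank F ↥(S / T) + Module.finrank F T ≤ Module.finrank F S + 1 := by
  by_cases hbot : S / T = ⊥
  · rw [hbot, finrank_bot, zero_add]
    exact hTS
  · have h1 := Submodule.finrank_mono (div_mul_le S T)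
    have h2 := h.finrank_add_le_finrank_mul _ T hbot hT
      fun e => hS (top_le_iff.1 (e ▸ div_mul_le S T))
    omega

/-- The equality forces (S / T) T = S, so (S / T, T) is a Vosper pair; the product of two
progressions of ratio x lies in one of length dim S. -/
theorem NoIntermediate.eq_smul_powerSpan_of_finrank_div [Finite F] (h : NoIntermediate F E)
    {S T : Submodule F E} (hT : 2 ≤ Module.finrank F T) (hdiv : 2 ≤ Module.finrank F ↥(S / T))
    (hST : Module.finrank F ↥(S / T) + Module.finrank F T = Module.finrank F S + 1)
    (hn : Module.finrank F S + 2 ≤ Module.finrank F E) :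
    ∃ g g' x : E, x ∉ Set.range (algebraMap F E) ∧ g ≠ 0 ∧ g' ≠ 0 ∧
      S = g • powerSpan F x (Module.finrank F S) ∧ T = g' • powerSpan F x (Module.finrank F T) := by
  have hle := div_mul_le S T
  have h1 := Submodule.finrank_mono hle
  have h2 := h.finrank_add_le_finrank_mul _ T (ne_bot_of_finrank hdiv) (ne_bot_of_finrank hT)
    (ne_top_of_finrank (by omega))
  have heq : S / T * T = S := Submodule.eq_of_le_of_finrank_eq hle (by omega)
  obtain ⟨g, g', x, hx, hg, hg', hX, hT'⟩ := h.vosper hdiv hT (by omega) (by omega)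
  refine ⟨g * g', g', x, hx, mul_ne_zero hg hg', hg', ?_, hT'⟩
  refine Submodule.eq_of_le_of_finrank_eq ?_ ?_
  · calc S = S / T * T := heq.symm
      _ = g • powerSpan F x (Module.finrank F ↥(S / T)) *
          g' • powerSpan F x (Module.finrank F T) := by rw [← hX, ← hT']
      _ ≤ _ := smul_powerSpan_mul_smul_powerSpan_le _ _ _ _ _
      _ = _ := by rw [hST, Nat.add_sub_cancel]
  · rw [finrank_smul (mul_ne_zero hg hg'), h.finrank_powerSpan hx (by omega)]

end Quotients

/-! ### Weights of points and normalisation to a product T × S. -/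

section Weights

variable {F E : Type*} [Field F] [Field E] [Algebra F E]

/-- The multipliers `c ∈ E` with `c • w ∈ U`. -/
def multipliers (U : Submodule F (E × E)) (w : E × E) : Submodule F E :=
  U.comap ((LinearMap.toSpanSingleton E (E × E) w).restrictScalars F)

theorem mem_multipliers {U : Submodule F (E × E)} {w : E × E} {c : E} :
    c ∈ multipliers U w ↔ c • w ∈ U := Iff.rfl

theorem weight_mk (U : Submodule F (E × E)) {w : E × E} (hw : w ≠ 0) :
    weight U (Projectivization.mk E w hw) = Module.finrank F (multipliers U w) := by
  have hinj : Function.Injective ((LinearMap.toSpanSingleton E (E × E) w).restrictScalars F) :=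
    fun a b hab => smul_left_injective E hw hab
  have : U ⊓ (Projectivization.mk E w hw).submodule.restrictScalars F =
      (multipliers U w).map ((LinearMap.toSpanSingleton E (E × E) w).restrictScalars F) := by
    ext v
    rw [Projectivization.submodule_mk, Submodule.mem_inf, Submodule.restrictScalars_mem,
      Submodule.mem_span_singleton, Submodule.mem_map]
    constructor
    · rintro ⟨hv, c, rfl⟩
      exact ⟨c, hv, rfl⟩
    · rintro ⟨c, hc, rfl⟩
      exact ⟨hc, c, rfl⟩
  rw [weight, this]
  exact (Submodule.equivMapOfInjective _ hinj _).finrank_eq.symm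

/-- The action of a linear automorphism on the points. -/
def pointEquiv (φ : (E × E) ≃ₗ[E] (E × E)) :
    Projectivization E (E × E) ≃ Projectivization E (E × E) where
  toFun := Projectivization.map φ.toLinearMap φ.injective
  invFun := Projectivization.map φ.symm.toLinearMap φ.symm.injective
  left_inv P := by
    induction P using Projectivization.ind with
    | h v hv => simp [Projectivization.map_mk]
  right_inv P := by
    induction P using Projectivization.ind with
    | h v hv => simp [Projectivization.map_mk]

theorem pointEquiv_mk (φ : (E × E) ≃ₗ[E] (E × E)) {v : E × E} (hv : v ≠ 0) :
    pointEquiv φ (Projectivization.mk E v hv) =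
      Projectivization.mk E (φ v) (φ.map_ne_zero_iff.2 hv) := rfl

theorem apply_mem_map_iff (φ : (E × E) ≃ₗ[E] (E × E)) (U : Submodule F (E × E)) (v : E × E) :
    φ v ∈ U.map (φ.toLinearMap.restrictScalars F) ↔ v ∈ U := by
  constructor
  · rintro ⟨u, hu, h⟩
    rwa [← φ.injective h]
  · exact fun h => ⟨v, h, rfl⟩

theorem weight_map (φ : (E × E) ≃ₗ[E] (E × E)) (U : Submodule F (E × E))
    (P : Projectivization E (E × E)) :
    weight (U.map (φ.toLinearMap.restrictScalars F)) (pointEquiv φ P) = weight U P := by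
  induction P using Projectivization.ind with
  | h v hv =>
    rw [pointEquiv_mk, weight_mk, weight_mk]
    suffices heq : multipliers (U.map (φ.toLinearMap.restrictScalars F)) (φ v) =
        multipliers U v by rw [heq]
    ext c
    rw [mem_multipliers, mem_multipliers, ← map_smul, apply_mem_map_iff]

theorem linearSet_map (φ : (E × E) ≃ₗ[E] (E × E)) (U : Submodule F (E × E)) :
    linearSet (U.map (φ.toLinearMap.restrictScalars F)) = pointEquiv φ '' linearSet U := by
  ext P
  constructor
  · rintro ⟨_, hu, ⟨u, hu', rfl⟩, rfl⟩
    have hu0 : u ≠ 0 := by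
      rintro rfl
      exact hu (map_zero _)
    exact ⟨Projectivization.mk E u hu0, ⟨u, hu0, hu', rfl⟩, rfl⟩
  · rintro ⟨_, ⟨u, hu, hu', rfl⟩, rfl⟩
    exact ⟨φ u, φ.map_ne_zero_iff.2 hu, (apply_mem_map_iff φ U u).2 hu', rfl⟩

theorem finrank_map_equiv (φ : (E × E) ≃ₗ[E] (E × E)) (U : Submodule F (E × E)) :
    Module.finrank F ↥(U.map (φ.toLinearMap.restrictScalars F)) = Module.finrank F U :=
  (Submodule.equivMapOfInjective (φ.toLinearMap.restrictScalars F) φ.injective U).finrank_eq.symm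

theorem isMinimumSize_of_map (φ : (E × E) ≃ₗ[E] (E × E)) {U : Submodule F (E × E)}
    (h : IsMinimumSize (U.map (φ.toLinearMap.restrictScalars F))) : IsMinimumSize U := by
  obtain ⟨⟨P, hP⟩, hcard⟩ := h
  refine ⟨⟨(pointEquiv φ).symm P, ?_⟩, ?_⟩
  · rw [← hP, ← weight_map φ, Equiv.apply_symm_apply]
  · rwa [linearSet_map, Set.ncard_image_of_injective _ (pointEquiv φ).injective,
      finrank_map_equiv] at hcard

theorem mk_one_injective : Function.Injective fun x : E =>
    Projectivization.mk E ((1 : E), x) (by simp) := by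
  intro x y hxy
  obtain ⟨a, ha⟩ := (Projectivization.mk_eq_mk_iff' E _ _ _ _).1 hxy
  have h1 : a * 1 = 1 := congrArg Prod.fst ha
  have h2 : a * y = x := congrArg Prod.snd ha
  rw [mul_one] at h1
  rw [← h2, h1, one_mul]

theorem mk_ne_iff {y z : E} (h : (y, z) ≠ (0 : E × E)) :
    Projectivization.mk E (y, z) h ≠ Projectivization.mk E ((0 : E), (1 : E)) (by simp) ↔
      y ≠ 0 := by
  rw [Ne, Projectivization.mk_eq_mk_iff', not_iff_not]
  constructor
  · rintro ⟨a, ha⟩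
    simpa using (congrArg Prod.fst ha).symm
  · rintro rfl
    exact ⟨z, by simp⟩

variable [FiniteDimensional F E]

theorem finrank_prod_submodule (T S : Submodule F E) :
    Module.finrank F ↥(T.prod S) = Module.finrank F T + Module.finrank F S := by
  have hinj : Function.Injective (T.subtype.prodMap S.subtype) :=
    Prod.map_injective.2 ⟨T.injective_subtype, S.injective_subtype⟩
  rw [← Module.finrank_prod, ← LinearMap.finrank_range_of_inj hinj, LinearMap.range_prodMap,
    Submodule.range_subtype, Submodule.range_subtype]

/-- A point other than ⟨(0,1)⟩ is some ⟨(1,x)⟩, with multipliers {c ∈ T : cx ∈ S}; full weight means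
that all of T qualifies. -/
theorem setOf_weight_prod_eq (S T : Submodule F E) :
    {Q | weight (T.prod S) Q = Module.finrank F T ∧
      Q ≠ Projectivization.mk E ((0 : E), (1 : E)) (by simp)} =
      (fun x : E => Projectivization.mk E ((1 : E), x) (by simp)) '' (S / T : Submodule F E) := by
  have key : ∀ x : E, weight (T.prod S) (Projectivization.mk E ((1 : E), x) (by simp)) =
      Module.finrank F T ↔ x ∈ S / T := by
    intro x
    have hle : multipliers (T.prod S) ((1 : E), x) ≤ T := by
      rintro c ⟨hc, -⟩
      simpa using hc
    rw [weight_mk, Submodule.mem_div_iff_forall_mul_mem]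
    constructor
    · intro h t ht
      rw [← Submodule.eq_of_le_of_finrank_eq hle h] at ht
      rw [mul_comm]
      exact ht.2
    · intro h
      rw [le_antisymm hle fun t ht => ⟨by simpa using ht, ?_⟩]
      rw [SetLike.mem_coe]
      have := h t ht
      rwa [mul_comm] at this
  ext Q
  constructor
  · rintro ⟨hQ, hne⟩
    induction Q using Projectivization.ind with
    | h v hv =>
      obtain ⟨y, z⟩ := v
      have hy := (mk_ne_iff hv).1 hne
      have heq : Projectivization.mk E (y, z) hv =
          Projectivization.mk E ((1 : E), z / y) (by simp) :=
        (Projectivization.mk_eq_mk_iff' E _ _ _ _).2 ⟨y, by simp [mul_div_cancel₀ z hy]⟩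
      rw [heq] at hQ ⊢
      exact ⟨_, (key _).1 hQ, rfl⟩
  · rintro ⟨x, hx, rfl⟩
    exact ⟨(key x).2 hx, (mk_ne_iff _).2 one_ne_zero⟩

theorem ncard_setOf_weight_prod [Finite F] (S T : Submodule F E) :
    {Q | weight (T.prod S) Q = Module.finrank F T ∧
      Q ≠ Projectivization.mk E ((0 : E), (1 : E)) (by simp)}.ncard =
      Nat.card F ^ Module.finrank F ↥(S / T) := by
  rw [setOf_weight_prod_eq, Set.ncard_image_of_injective _ mk_one_injective,
    ← Module.natCard_eq_pow_finrank, ← Nat.card_coe_set_eq]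
  rfl

theorem exists_equiv_pair {P Q : Projectivization E (E × E)} (h : P ≠ Q) :
    ∃ φ : (E × E) ≃ₗ[E] (E × E),
      pointEquiv φ P = Projectivization.mk E ((0 : E), (1 : E)) (by simp) ∧
      pointEquiv φ Q = Projectivization.mk E ((1 : E), (0 : E)) (by simp) := by
  have hli := Projectivization.linearIndependent_pair_iff_ne.2 h
  rw [LinearIndependent.pair_iff] at hli
  let f : (E × E) →ₗ[E] (E × E) := (LinearMap.toSpanSingleton E (E × E) Q.rep).coprod
    (LinearMap.toSpanSingleton E (E × E) P.rep)
  have hf : Function.Injective f := by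
    rw [← LinearMap.ker_eq_bot, LinearMap.ker_eq_bot']
    rintro ⟨y, z⟩ hyz
    obtain ⟨h1, h2⟩ := hli z y (by rw [add_comm]; exact hyz)
    rw [h1, h2]
    rfl
  let ψ := LinearEquiv.ofInjectiveEndo f hf
  have h01 : ψ ((0 : E), (1 : E)) = P.rep := by
    change (0 : E) • Q.rep + (1 : E) • P.rep = P.rep
    rw [zero_smul, one_smul, zero_add]
  have h10 : ψ ((1 : E), (0 : E)) = Q.rep := by
    change (1 : E) • Q.rep + (0 : E) • P.rep = Q.rep
    rw [zero_smul, one_smul, add_zero]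
  refine ⟨ψ.symm, ?_, ?_⟩
  · conv_lhs => rw [← P.mk_rep, pointEquiv_mk]
    congr 1
    rw [← h01, LinearEquiv.symm_apply_apply]
  · conv_lhs => rw [← Q.mk_rep, pointEquiv_mk]
    congr 1
    rw [← h10, LinearEquiv.symm_apply_apply]

theorem weight_add_weight_le {U : Submodule F (E × E)} {P Q : Projectivization E (E × E)}
    (h : P ≠ Q) : weight U P + weight U Q ≤ Module.finrank F U := by
  obtain ⟨φ, hP, hQ⟩ := exists_equiv_pair h
  rw [← weight_map φ U P, ← weight_map φ U Q, ← finrank_map_equiv φ U, hP, hQ, weight_mk,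
    weight_mk, add_comm, ← finrank_prod_submodule]
  refine Submodule.finrank_mono ?_
  rintro ⟨y, z⟩ ⟨hy, hz⟩
  have := add_mem (mem_multipliers.1 hy) (mem_multipliers.1 hz)
  simpa using this

theorem HasComplementaryWeights.exists_map_eq_prod {U : Submodule F (E × E)} {a b : ℕ}
    (h : HasComplementaryWeights U a b) {P : Projectivization E (E × E)} (hP : weight U P = a) :
    ∃ (φ : (E × E) ≃ₗ[E] (E × E)) (T S : Submodule F E),
      U.map (φ.toLinearMap.restrictScalars F) = T.prod S ∧
      pointEquiv φ P = Projectivization.mk E ((0 : E), (1 : E)) (by simp) ∧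
      Module.finrank F T = b ∧ Module.finrank F S = a := by
  obtain ⟨hba, hU, P', Q', hne, hP', hQ'⟩ := h
  obtain ⟨Q, hPQ, hQ⟩ : ∃ Q, P ≠ Q ∧ weight U Q = b := by
    by_cases hPP : P = P'
    · exact ⟨Q', hPP ▸ hne, hQ'⟩
    -- Here P and P' both have weight a, so 2a ≤ a + b; with b ≤ a this gives a = b, and P' serves
    -- as the second point.
    · have := weight_add_weight_le (U := U) hPP
      exact ⟨P', hPP, by omega⟩
  obtain ⟨φ, hφP, hφQ⟩ := exists_equiv_pair hPQ
  have h1 := weight_map φ U P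
  have h2 := weight_map φ U Q
  have h3 := finrank_map_equiv φ U
  rw [hφP, weight_mk, hP] at h1
  rw [hφQ, weight_mk, hQ] at h2
  refine ⟨φ, _, _, (Submodule.eq_of_le_of_finrank_eq ?_ ?_).symm, hφP, h2, h1⟩
  · rintro ⟨y, z⟩ ⟨hy, hz⟩
    have := add_mem (mem_multipliers.1 hy) (mem_multipliers.1 hz)
    simpa using this
  · rw [finrank_prod_submodule, h1, h2, h3, hU, add_comm]

end Weights

/-! ### The number of points for a product of two power spans. -/

section MinimumSize

variable {F E : Type*} [Field F] [Field E] [Algebra F E]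

theorem mem_powerSpan_succ {x y : E} {m : ℕ} (hy : y ∈ powerSpan F x (m + 1)) :
    ∃ p ∈ powerSpan F x m, ∃ α : F, y = p + α • x ^ m := by
  rw [powerSpan_succ] at hy
  obtain ⟨p, hp, t, ht, rfl⟩ := Submodule.mem_sup.1 hy
  obtain ⟨α, rfl⟩ := Submodule.mem_span_singleton.1 ht
  exact ⟨p, hp, α, rfl⟩

theorem mul_mem_powerSpan {x p r : E} {a b c : ℕ} (hp : p ∈ powerSpan F x a)
    (hr : r ∈ powerSpan F x b) (h : a + b ≤ c + 1) : p * r ∈ powerSpan F x c :=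
  powerSpan_mono x (by omega) (powerSpan_mul_le x a b (Submodule.mul_mem_mul hp hr))

theorem powerSpan_add_le (x : E) (a b : ℕ) :
    powerSpan F x (a + b) ≤ powerSpan F x a ⊔ x ^ a • powerSpan F x b := by
  refine powerSpan_le_iff.2 fun i hi => ?_
  by_cases h : i < a
  · exact Submodule.mem_sup_left (pow_mem_powerSpan x h)
  · have := mul_mem_smul (x := x ^ a) (pow_mem_powerSpan (F := F) x (show i - a < b by omega))
    rw [← pow_add, Nat.add_sub_cancel' (by omega)] at this
    exact Submodule.mem_sup_right this

theorem mem_multipliers_powerSpan {x c : E} {a b : ℕ} {w : E × E} :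
    c ∈ multipliers ((powerSpan F x a).prod (powerSpan F x b)) w ↔
      c * w.1 ∈ powerSpan F x a ∧ c * w.2 ∈ powerSpan F x b := Iff.rfl

/-- If the two agreed, multiplication by x would preserve them, so they would be all of E, which is
too large for a power span of length below [E : F]. -/
theorem NoIntermediate.multipliers_ne (h : NoIntermediate F E) {x : E}
    (hx : x ∉ Set.range (algebraMap F E)) {a b : ℕ} (ha : a + 1 < Module.finrank F E)
    (hb : b + 1 < Module.finrank F E) {w : E × E} (hw : w ≠ 0)
    (hmem : w ∈ (powerSpan F x (a + 1)).prod (powerSpan F x (b + 1))) :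
    multipliers ((powerSpan F x a).prod (powerSpan F x b)) w ≠
      multipliers ((powerSpan F x (a + 1)).prod (powerSpan F x (b + 1))) w := by
  intro heq
  have htop : multipliers ((powerSpan F x (a + 1)).prod (powerSpan F x (b + 1))) w = ⊤ := by
    refine h.eq_top_of_mul_mem hx ((Submodule.ne_bot_iff _).2 ⟨1, ?_, one_ne_zero⟩) ?_
    · rwa [mem_multipliers, one_smul]
    · intro c hc
      rw [← heq, mem_multipliers_powerSpan] at hc
      rw [mem_multipliers_powerSpan, mul_assoc, mul_assoc]
      exact ⟨smul_le_iff.1 (smul_powerSpan_le x a) _ hc.1,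
        smul_le_iff.1 (smul_powerSpan_le x b) _ hc.2⟩
  have key : ∀ {m : ℕ} {y : E}, m < Module.finrank F E → y ≠ 0 →
      ¬ ∀ c : E, c * y ∈ powerSpan F x m := by
    intro m y hm hy hall
    have : powerSpan F x m = ⊤ := by
      rw [eq_top_iff]
      intro e _
      have := hall (e * y⁻¹)
      rwa [inv_mul_cancel_right₀ hy] at this
    exact absurd (finrank_powerSpan_le (F := F) x m) (by rw [this, finrank_top]; omega)
  have hall : ∀ c, c ∈ multipliers ((powerSpan F x (a + 1)).prod (powerSpan F x (b + 1))) w :=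
    fun c => by rw [htop]; trivial
  by_cases h1 : w.1 = 0
  · exact key hb (fun h2 => hw (Prod.ext h1 h2)) fun c => (hall c).2
  · exact key ha h1 fun c => (hall c).1

variable [FiniteDimensional F E]

/-- The top coefficients of two multiples of the same vector are proportional. -/
theorem NoIntermediate.top_coeff_mul_eq (h : NoIntermediate F E) {x : E}
    (hx : x ∉ Set.range (algebraMap F E)) {a b : ℕ} (hab : a + b < Module.finrank F E)
    {p p' r r' : E} (hp : p ∈ powerSpan F x a) (hp' : p' ∈ powerSpan F x a)
    (hr : r ∈ powerSpan F x b) (hr' : r' ∈ powerSpan F x b) {α α' β β' : F}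
    (heq : (p + α • x ^ a) * (r' + β' • x ^ b) = (p' + α' • x ^ a) * (r + β • x ^ b)) :
    α * β' = α' * β := by
  by_contra hne
  -- Comparison of coefficients of x^(a+b): all other terms have lower degree, and x^(a+b) is
  -- independent of them since a + b < [E : F].
  have hmem : (α * β' - α' * β) • x ^ (a + b) ∈ powerSpan F x (a + b) := by
    have hxa := pow_mem_powerSpan (F := F) x a.lt_succ_self
    have hxb := pow_mem_powerSpan (F := F) x b.lt_succ_self
    have h1 : p' * (r + β • x ^ b) + α' • (x ^ a * r) -
        (p * (r' + β' • x ^ b) + α • (x ^ a * r')) ∈ powerSpan F x (a + b) := by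
      have hb1 : ∀ s ∈ powerSpan F x b, ∀ γ : F, s + γ • x ^ b ∈ powerSpan F x (b + 1) :=
        fun s hs γ => add_mem (powerSpan_mono x b.le_succ hs) (Submodule.smul_mem _ _ hxb)
      exact sub_mem
        (add_mem (mul_mem_powerSpan hp' (hb1 r hr β) (by omega))
          (Submodule.smul_mem _ _ (mul_mem_powerSpan hxa hr (by omega))))
        (add_mem (mul_mem_powerSpan hp (hb1 r' hr' β') (by omega))
          (Submodule.smul_mem _ _ (mul_mem_powerSpan hxa hr' (by omega))))
    convert h1 using 1
    simp only [Algebra.smul_def, map_sub, map_mul] at heq ⊢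
    rw [pow_add]
    linear_combination heq
  exact h.pow_notMem_powerSpan hx hab
    ((Submodule.smul_mem_iff _ (sub_ne_zero.2 hne)).1 hmem)

/-- Lowering both degrees by one lowers the weight of every point by one. -/
theorem NoIntermediate.finrank_multipliers_succ (h : NoIntermediate F E) {x : E}
    (hx : x ∉ Set.range (algebraMap F E)) {a b : ℕ} (hab : a + b + 1 < Module.finrank F E)
    {w : E × E} (hw : w ≠ 0)
    (hmem : w ∈ (powerSpan F x (a + 1)).prod (powerSpan F x (b + 1))) :
    Module.finrank F
        (multipliers ((powerSpan F x (a + 1)).prod (powerSpan F x (b + 1))) w) =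
      Module.finrank F (multipliers ((powerSpan F x a).prod (powerSpan F x b)) w) + 1 := by
  set N' := multipliers ((powerSpan F x (a + 1)).prod (powerSpan F x (b + 1))) w
  set N := multipliers ((powerSpan F x a).prod (powerSpan F x b)) w
  have hle : N ≤ N' := fun c hc =>
    ⟨powerSpan_mono x a.le_succ hc.1, powerSpan_mono x b.le_succ hc.2⟩
  have hne : N ≠ N' := h.multipliers_ne hx (by omega) (by omega) hw hmem
  have hlt := Submodule.finrank_lt_finrank_of_lt (lt_of_le_of_ne hle hne)
  obtain ⟨c₀, hc₀, hc₀N⟩ := SetLike.exists_of_lt (lt_of_le_of_ne hle hne)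
  obtain ⟨p₀, hp₀, α₀, hα₀⟩ := mem_powerSpan_succ hc₀.1
  obtain ⟨r₀, hr₀, β₀, hβ₀⟩ := mem_powerSpan_succ hc₀.2
  change c₀ * w.1 = _ at hα₀
  change c₀ * w.2 = _ at hβ₀
  have hnz : α₀ ≠ 0 ∨ β₀ ≠ 0 := by
    by_contra! hcon
    refine hc₀N (mem_multipliers_powerSpan.2 ⟨?_, ?_⟩)
    · rw [hα₀, hcon.1, zero_smul, add_zero]
      exact hp₀
    · rw [hβ₀, hcon.2, zero_smul, add_zero]
      exact hr₀
  -- The pairs of top coefficients are all proportional to (α₀, β₀), so subtracting a multiple of c₀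
  -- removes both at once.
  have hsup : N' ≤ N ⊔ Submodule.span F {c₀} := by
    intro c hc
    obtain ⟨p, hp, α, hα⟩ := mem_powerSpan_succ hc.1
    obtain ⟨r, hr, β, hβ⟩ := mem_powerSpan_succ hc.2
    change c * w.1 = _ at hα
    change c * w.2 = _ at hβ
    have hprop : α * β₀ = α₀ * β := by
      refine h.top_coeff_mul_eq hx (by omega) hp hp₀ hr hr₀ ?_
      rw [← hα, ← hβ, ← hα₀, ← hβ₀]
      ring
    obtain ⟨μ, hμ1, hμ2⟩ : ∃ μ : F, α = μ * α₀ ∧ β = μ * β₀ := by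
      rcases hnz with h0 | h0
      · exact ⟨α / α₀, by field_simp, by field_simp; linear_combination -hprop⟩
      · exact ⟨β / β₀, by field_simp; linear_combination hprop, by field_simp⟩
    have hsub : c - μ • c₀ ∈ N := by
      refine mem_multipliers_powerSpan.2 ⟨?_, ?_⟩
      · rw [sub_mul, smul_mul_assoc, hα, hα₀, hμ1, smul_add, mul_smul, add_sub_add_right_eq_sub]
        exact sub_mem hp (Submodule.smul_mem _ _ hp₀)
      · rw [sub_mul, smul_mul_assoc, hβ, hβ₀, hμ2, smul_add, mul_smul, add_sub_add_right_eq_sub]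
        exact sub_mem hr (Submodule.smul_mem _ _ hr₀)
    rw [← sub_add_cancel c (μ • c₀)]
    exact add_mem (Submodule.mem_sup_left hsub)
      (Submodule.mem_sup_right (Submodule.smul_mem _ _ (Submodule.mem_span_singleton_self c₀)))
  have h1 := Submodule.finrank_mono hsup
  have h2 := Submodule.finrank_sup_add_finrank_inf_eq N (Submodule.span F {c₀})
  have h3 := finrank_span_le_card (R := F) ({c₀} : Set E)
  simp only [Set.toFinset_singleton, Finset.card_singleton] at h3
  omega

theorem weight_ne_zero_iff (U : Submodule F (E × E)) (P : Projectivization E (E × E)) :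
    weight U P ≠ 0 ↔ P ∈ linearSet U := by
  induction P using Projectivization.ind with
  | h v hv =>
    rw [weight_mk, ← Nat.one_le_iff_ne_zero, Submodule.one_le_finrank_iff, Submodule.ne_bot_iff]
    constructor
    · rintro ⟨c, hc, hc0⟩
      refine ⟨c • v, smul_ne_zero hc0 hv, hc, ?_⟩
      rw [Projectivization.mk_eq_mk_iff']
      exact ⟨c⁻¹, by rw [inv_smul_smul₀ hc0]⟩
    · rintro ⟨u, hu, hmem, h⟩
      obtain ⟨c, hc⟩ := (Projectivization.mk_eq_mk_iff' E _ _ _ _).1 h.symm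
      refine ⟨c, ?_, ?_⟩
      · rw [mem_multipliers, hc]
        exact hmem
      · rintro rfl
        exact hu (by rw [← hc, zero_smul])

theorem card_filter_ne_zero [Finite F] [Fintype {v : E × E // v ≠ 0}] (W : Submodule F (E × E))
    [DecidablePred fun v : {v : E × E // v ≠ 0} => (v : E × E) ∈ W] :
    (Finset.univ.filter fun v : {v : E × E // v ≠ 0} => (v : E × E) ∈ W).card + 1 =
      Nat.card F ^ Module.finrank F W := by
  classical
  have : Finite E := Module.finite_of_finite F
  have := Fintype.ofFinite W
  rw [← Module.natCard_eq_pow_finrank, Nat.card_eq_fintype_card, ← Finset.card_univ,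
    ← Finset.card_erase_add_one (Finset.mem_univ (0 : W))]
  congr 1
  refine Finset.card_bij (fun v hv => ⟨v, (Finset.mem_filter.1 hv).2⟩) ?_ ?_ ?_
  · intro v hv
    exact Finset.mem_erase.2 ⟨fun h => v.2 (congrArg Subtype.val h), Finset.mem_univ _⟩
  · intro v _ v' _ h
    exact Subtype.ext (congrArg (fun z : W => (z : E × E)) h)
  · intro v hv
    exact ⟨⟨v, fun h => (Finset.mem_erase.1 hv).1 (Subtype.ext h)⟩,
      Finset.mem_filter.2 ⟨Finset.mem_univ _, v.2⟩, rfl⟩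

/-- The nonzero vectors of `U`, counted point by point. -/
theorem card_eq_sum_weight [Finite F] [Fintype (Projectivization E (E × E))]
    (U : Submodule F (E × E)) :
    ∑ P : Projectivization E (E × E), ((Nat.card F : ℤ) ^ weight U P - 1) =
      (Nat.card F : ℤ) ^ Module.finrank F U - 1 := by
  classical
  have : Finite E := Module.finite_of_finite F
  have := Fintype.ofFinite {v : E × E // v ≠ 0}
  have h1 := card_filter_ne_zero U
  rw [Finset.card_eq_sum_card_fiberwise (f := Projectivization.mk' E) (t := Finset.univ)
    (fun _ _ => Finset.mem_coe.2 (Finset.mem_univ _))] at h1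
  have h2 : ∀ P : Projectivization E (E × E), ((Finset.univ.filter
      fun v : {v : E × E // v ≠ 0} => (v : E × E) ∈ U).filter
        fun v => Projectivization.mk' E v = P).card + 1 = Nat.card F ^ weight U P := by
    intro P
    rw [weight, ← card_filter_ne_zero, Finset.filter_filter]
    congr 2
    ext v
    simp only [Finset.mem_filter, Finset.mem_univ, true_and, Submodule.mem_inf,
      Submodule.restrictScalars_mem]
    refine and_congr_right fun _ => ?_
    induction P using Projectivization.ind with
    | h w hw =>
      rw [Projectivization.mk'_eq_mk, Projectivization.mk_eq_mk_iff', Projectivization.submodule_mk,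
        Submodule.mem_span_singleton]
  have h1' := congrArg (Nat.cast : ℕ → ℤ) h1
  push_cast at h1'
  rw [← h1', add_sub_cancel_right]
  refine Finset.sum_congr rfl fun P _ => ?_
  have := congrArg (Nat.cast : ℕ → ℤ) (h2 P)
  push_cast at this
  linarith

/-- With U the product of the shortened spans, weights in U' are one more than in U on L_{U'} and
zero elsewhere. Summing q^weight - 1 over points gives q^(a+b+2) - 1 = q(q^(a+b) - 1) + (q -
1)|L_{U'}|. -/
theorem NoIntermediate.isMinimumSize_powerSpan [Finite F] (h : NoIntermediate F E) {x : E}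
    (hx : x ∉ Set.range (algebraMap F E)) {a b : ℕ} (hab : a + b + 1 < Module.finrank F E) :
    IsMinimumSize ((powerSpan F x (a + 1)).prod (powerSpan F x (b + 1))) := by
  classical
  have hx0 := ne_zero_of_notMem_range hx
  set U' := (powerSpan F x (a + 1)).prod (powerSpan F x (b + 1)) with hU'
  set U := (powerSpan F x a).prod (powerSpan F x b) with hU
  constructor
  · have hw : ((x ^ a, 1) : E × E) ≠ 0 := by simp
    refine ⟨Projectivization.mk E (x ^ a, 1) hw, ?_⟩
    rw [weight_mk, h.finrank_multipliers_succ hx hab hw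
      ⟨pow_mem_powerSpan x a.lt_succ_self, by
        simpa using pow_mem_powerSpan (F := F) x b.succ_pos⟩]
    suffices heq : multipliers U (x ^ a, 1) = ⊥ by rw [heq, finrank_bot]
    -- The two spans are independent because together they fill the span of 1, …, x^(a+b-1), of
    -- dimension a + b; so (x^a, 1) has weight 0 for U and 1 for U'.
    have hbot : powerSpan F x a ⊓ x ^ a • powerSpan F x b = ⊥ := by
      have h1 := finrank_sup_smul_add_inf (pow_ne_zero a hx0) (powerSpan F x a) (powerSpan F x b)
      have h2 := Submodule.finrank_mono (powerSpan_add_le (F := F) x a b)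
      rw [h.finrank_powerSpan hx (by omega)] at h1 h2
      rw [h.finrank_powerSpan hx (by omega)] at h1
      exact Submodule.finrank_eq_zero.1 (by omega)
    rw [eq_bot_iff]
    intro c hc
    obtain ⟨hc1, hc2⟩ := mem_multipliers_powerSpan.1 hc
    have : c * x ^ a ∈ powerSpan F x a ⊓ x ^ a • powerSpan F x b := by
      refine ⟨hc1, ?_⟩
      rw [mul_one] at hc2
      rw [mul_comm]
      exact mul_mem_smul hc2
    rw [hbot, Submodule.mem_bot] at this
    exact (Submodule.mem_bot F).2 ((mul_eq_zero.1 this).resolve_right (pow_ne_zero a hx0))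
  · have : Finite E := Module.finite_of_finite F
    have : Finite (Projectivization E (E × E)) :=
      (Projectivization.finite_iff_of_finite E (E × E)).2 inferInstance
    have := Fintype.ofFinite (Projectivization E (E × E))
    have hrank' : Module.finrank F U' = a + 1 + (b + 1) := by
      rw [hU', finrank_prod_submodule, h.finrank_powerSpan hx (by omega),
        h.finrank_powerSpan hx (by omega)]
    have hrank : Module.finrank F U = a + b := by
      rw [hU, finrank_prod_submodule, h.finrank_powerSpan hx (by omega),
        h.finrank_powerSpan hx (by omega)]
    have hle : U ≤ U' := Submodule.prod_mono (powerSpan_mono x a.le_succ)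
      (powerSpan_mono x b.le_succ)
    have hterm : ∀ P : Projectivization E (E × E), ((Nat.card F : ℤ) ^ weight U' P - 1) =
        Nat.card F * ((Nat.card F : ℤ) ^ weight U P - 1) +
          if P ∈ linearSet U' then (Nat.card F : ℤ) - 1 else 0 := by
      intro P
      split_ifs with hP
      · have : weight U' P = weight U P + 1 := by
          obtain ⟨w, hw, hmem, rfl⟩ := hP
          rw [weight_mk, weight_mk, h.finrank_multipliers_succ hx hab hw hmem]
        rw [this]
        ring
      · have h1 : weight U' P = 0 := by
          by_contra hcon
          exact hP ((weight_ne_zero_iff U' P).1 hcon)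
        have h2 : weight U P = 0 := by
          by_contra hcon
          obtain ⟨w, hw, hmem, rfl⟩ := (weight_ne_zero_iff U P).1 hcon
          exact hP ⟨w, hw, hle hmem, rfl⟩
        rw [h1, h2]
        ring
    have hsum := card_eq_sum_weight U'
    rw [Finset.sum_congr rfl fun P _ => hterm P, Finset.sum_add_distrib, ← Finset.mul_sum,
      card_eq_sum_weight U, ← Finset.sum_filter, Finset.sum_const, nsmul_eq_mul, hrank,
      hrank'] at hsum
    have hcard : (Finset.univ.filter fun P => P ∈ linearSet U').card = (linearSet U').ncard := by
      rw [← Set.ncard_coe_finset]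
      congr 1
      ext P
      simp
    rw [hcard] at hsum
    have hq : (1 : ℤ) < Nat.card F := by exact_mod_cast Finite.one_lt_card
    have hfin : ((linearSet U').ncard : ℤ) = (Nat.card F : ℤ) ^ (a + b + 1) + 1 := by
      apply mul_right_cancel₀ (sub_ne_zero.2 hq.ne')
      rw [show a + 1 + (b + 1) = a + b + 2 by ring] at hsum
      linear_combination hsum
    rw [hrank', show a + 1 + (b + 1) - 1 = a + b + 1 by omega]
    exact_mod_cast hfin

end MinimumSize

/-! ### Reduction to the Jena–Van de Voorde form. -/

section JenaVanDeVoorde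

variable {F E : Type*} [Field F] [Field E] [Algebra F E]

/-- Rescaling of the two coordinates. -/
theorem exists_equiv_prod_smul {g g' : E} (hg : g ≠ 0) (hg' : g' ≠ 0) (T S : Submodule F E) :
    ∃ φ : (E × E) ≃ₗ[E] (E × E),
      ((g' • T).prod (g • S)).map (φ.toLinearMap.restrictScalars F) = T.prod S := by
  refine ⟨(LinearEquiv.smulOfNeZero E E g'⁻¹ (inv_ne_zero hg')).prodCongr
    (LinearEquiv.smulOfNeZero E E g⁻¹ (inv_ne_zero hg)), ?_⟩
  ext ⟨y, z⟩
  constructor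
  · rintro ⟨⟨t, s⟩, ⟨ht, hs⟩, heq⟩
    rw [← heq]
    exact ⟨(mem_smul_iff hg').1 ht, (mem_smul_iff hg).1 hs⟩
  · rintro ⟨hy, hz⟩
    exact ⟨(g' * y, g * z), ⟨mul_mem_smul hy, mul_mem_smul hz⟩,
      Prod.ext (inv_mul_cancel_left₀ hg' y) (inv_mul_cancel_left₀ hg z)⟩

variable [FiniteDimensional F E]

/-- If at least `q ^ (dim S - dim T) + 1` multiples of `T` lie in `S`, then `S` and `T` are spanned
by geometric progressions of the same ratio. -/
theorem NoIntermediate.exists_powerSpan_of_pow_lt [Finite F] (h : NoIntermediate F E)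
    {S T : Submodule F E} (hT : 2 ≤ Module.finrank F T)
    (hTS : Module.finrank F T ≤ Module.finrank F S)
    (hn : Module.finrank F S + 2 ≤ Module.finrank F E)
    (hcase : Module.finrank F T < Module.finrank F S ∨ Module.finrank F T = 2)
    (hdiv : Module.finrank F S - Module.finrank F T < Module.finrank F ↥(S / T)) :
    ∃ g g' x : E, x ∉ Set.range (algebraMap F E) ∧ g ≠ 0 ∧ g' ≠ 0 ∧
      S = g • powerSpan F x (Module.finrank F S) ∧ T = g' • powerSpan F x (Module.finrank F T) := by
  have hle := h.finrank_div_add_le (ne_top_of_finrank (by omega : Module.finrank F S < _))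
    (ne_bot_of_finrank hT) (by omega)
  by_cases hlt : Module.finrank F T < Module.finrank F S
  · exact h.eq_smul_powerSpan_of_finrank_div hT (by omega) (by omega) hn
  -- Now dim S = dim T = 2 and Vosper does not apply, as S / T is only a line; but S = yT and T is a
  -- plane.
  · obtain ⟨y, hy, hy0⟩ := (Submodule.ne_bot_iff _).1
      (Submodule.one_le_finrank_iff.1 (by omega : 1 ≤ Module.finrank F ↥(S / T)))
    have hST : y • T = S := Submodule.eq_of_le_of_finrank_eq
      (smul_le_iff.2 fun t ht => Submodule.mem_div_iff_forall_mul_mem.1 hy t ht)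
      (by rw [finrank_smul hy0]; omega)
    obtain ⟨x, hx, hxT⟩ := isGeometric_of_finrank_eq_two (hcase.resolve_left hlt)
    obtain ⟨g, hg, hTg⟩ := h.eq_smul_powerSpan hx (ne_bot_of_finrank hT)
      (ne_top_of_finrank (by omega)) hxT
    refine ⟨y * g, g, x, hx, mul_ne_zero hy0 hg, hg, ?_, hTg⟩
    rw [← smul_smul_submodule, show Module.finrank F S = Module.finrank F T by omega, ← hTg, hST]

theorem NoIntermediate.isJenaVanDeVoorde (h : NoIntermediate F E) {x : E}
    (hx : x ∉ Set.range (algebraMap F E)) {a b : ℕ} (ha : 1 ≤ a) (hb : 1 ≤ b)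
    (hab : a + b ≤ Module.finrank F E + 1) :
    IsJenaVanDeVoorde ((powerSpan F x a).prod (powerSpan F x b)) a b := by
  refine ⟨x, hx, ha, hb, ?_, rfl⟩
  rwa [IntermediateField.adjoin.finrank (IsIntegral.of_finite F x), h.natDegree_minpoly hx]

end JenaVanDeVoorde

end LinSet

theorem mainTheorem2 {F E : Type*} [Field F] [Finite F] [Field E] [Algebra F E]
    (n k r : ℕ) (hn : n.Prime) (hE : Module.finrank F E = n)
    (hkn : k ≤ n) (hrk : r < k) (hr : 2 ≤ r) :
    (∀ (S T : Submodule F E) (a : Fin r → E),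
      r ≤ k - r → Module.finrank F S = k - r → Module.finrank F T = r →
      T = Submodule.span F (Set.range a) →
      Module.finrank F ↥(⨅ i, (a i)⁻¹ • S) ≤ k - 2 * r + 1 ∧
      (Module.finrank F ↥(⨅ i, (a i)⁻¹ • S) = k - 2 * r + 1 → 2 ≤ k - 2 * r + 1 →
        ∃ g g' x : E, S = g • LinSet.powerSpan F x (k - r) ∧
          T = g' • LinSet.powerSpan F x r)) ∧
    (∀ (U : Submodule F (E × E)) (P : Projectivization E (E × E)),
      LinSet.HasComplementaryWeights U (k - r) r → LinSet.weight U P = k - r →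
      {Q | LinSet.weight U Q = r ∧ Q ≠ P}.ncard ≤ Nat.card F ^ (k - 2 * r + 1) ∧
      (2 * r < k ∨ r = 2 →
        Nat.card F ^ (k - 2 * r) + 1 ≤ {Q | LinSet.weight U Q = r ∧ Q ≠ P}.ncard →
        LinSet.IsMinimumSize U ∧
        ∃ φ : (E × E) ≃ₗ[E] (E × E),
          LinSet.IsJenaVanDeVoorde
            (U.map (φ.toLinearMap.restrictScalars F)) r (k - r))) := by
  have : FiniteDimensional F E := Module.finite_of_finrank_pos (by rw [hE]; exact hn.pos)
  have h : LinSet.NoIntermediate F E := LinSet.noIntermediate_of_prime (hE ▸ hn)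
  constructor
  · intro S T a hrkr hS hT hTa
    -- The r generators of an r-dimensional space are independent, so none vanishes and the default
    -- 0⁻¹ = 0 does not interfere.
    have ha : ∀ i, a i ≠ 0 := by
      have hli : LinearIndependent F a := by
        rw [linearIndependent_iff_card_eq_finrank_span, Fintype.card_fin, Set.finrank, ← hTa, hT]
      exact fun i => hli.ne_zero i
    rw [LinSet.iInf_inv_smul_eq_div ha, ← hTa]
    refine ⟨?_, fun hj h2 => ?_⟩
    · have := h.finrank_div_add_le (LinSet.ne_top_of_finrank (by omega : Module.finrank F S < _))
        (LinSet.ne_bot_of_finrank (by omega : 2 ≤ Module.finrank F T)) (by omega)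
      omega
    · obtain ⟨g, g', x, -, -, -, hSg, hTg⟩ :=
        h.eq_smul_powerSpan_of_finrank_div (S := S) (T := T) (by omega) (by omega) (by omega)
          (by omega)
      rw [hS] at hSg
      rw [hT] at hTg
      exact ⟨g, g', x, hSg, hTg⟩
  · intro U P hU hP
    obtain ⟨φ, T, S, hmap, hφP, hT, hS⟩ := hU.exists_map_eq_prod hP
    have hrkr := hU.1
    have hset : LinSet.pointEquiv φ '' {Q | LinSet.weight U Q = r ∧ Q ≠ P} =
        {Q | LinSet.weight (T.prod S) Q = Module.finrank F T ∧
          Q ≠ Projectivization.mk E ((0 : E), (1 : E)) (by simp)} := by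
      ext Q
      obtain ⟨Q, rfl⟩ := (LinSet.pointEquiv φ).surjective Q
      rw [(LinSet.pointEquiv φ).injective.mem_set_image, Set.mem_ofPred_eq, Set.mem_ofPred_eq,
        ← hmap, LinSet.weight_map, hT, ← hφP, Ne, Ne, (LinSet.pointEquiv φ).injective.eq_iff]
    have hcard : {Q | LinSet.weight U Q = r ∧ Q ≠ P}.ncard =
        Nat.card F ^ Module.finrank F ↥(S / T) := by
      rw [← Set.ncard_image_of_injective _ (LinSet.pointEquiv φ).injective, hset,
        LinSet.ncard_setOf_weight_prod]
    rw [hcard]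
    have hle := h.finrank_div_add_le
      (LinSet.ne_top_of_finrank (by omega : Module.finrank F S < _))
      (LinSet.ne_bot_of_finrank (by omega : 2 ≤ Module.finrank F T)) (by omega)
    refine ⟨Nat.pow_le_pow_right Nat.card_pos (by omega), fun hcase hpow => ?_⟩
    -- The count is a power of q, so exceeding q^(k-2r) means that its exponent exceeds k - 2r.
    have hdiv := (Nat.pow_lt_pow_iff_right Finite.one_lt_card).1 (Nat.lt_of_succ_le hpow)
    obtain ⟨g, g', x, hx, hg, hg', hSg, hTg⟩ := h.exists_powerSpan_of_pow_lt
      (S := S) (T := T) (by omega) (by omega) (by omega) (by omega) (by omega)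
    rw [hS] at hSg
    rw [hT] at hTg
    obtain ⟨φ', hφ'⟩ := LinSet.exists_equiv_prod_smul hg hg' (LinSet.powerSpan F x r)
      (LinSet.powerSpan F x (k - r))
    have hmap' : U.map ((φ.trans φ').toLinearMap.restrictScalars F) =
        (LinSet.powerSpan F x r).prod (LinSet.powerSpan F x (k - r)) := by
      rw [← hφ', ← hSg, ← hTg, ← hmap, ← Submodule.map_comp]
      rfl
    refine ⟨LinSet.isMinimumSize_of_map (φ.trans φ') ?_, φ.trans φ', ?_⟩
    · rw [hmap']
      have := h.isMinimumSize_powerSpan hx (a := r - 1) (b := k - r - 1) (by omega)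
      rwa [Nat.sub_add_cancel (by omega), Nat.sub_add_cancel (by omega)] at this
    · rw [hmap']
      exact h.isJenaVanDeVoorde hx (by omega) (by omega) (by omega)
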